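/- Let $n\ge 4$ and $m=\lfloor\frac{n-1}{2}\rfloor$. Partial permutations of $\{1<2<\cdots<n\}$ are written on the right and composed from left to right. Let $\mathcal{D}_{2n}$ be the group of permutations of $\{1,\dots,n\}$ generated by the $n$-cycle $g=(1\,2\,\cdots\,n)$ and the reflection $h: p\mapsto n+1-p$, and let $\mathcal{ODI}_n$ be the monoid of all partial permutations $\alpha$ of $\{1,\dots,n\}$ that are restrictions of elements of $\mathcal{D}_{2n}$ and are order-preserving (that is, $p\le q$ implies $p\alpha\le q\alpha$ for all $p,q$ in the domain of $\alpha$). Consider the following elements of $\mathcal{ODI}_n$: the map $x$ with domain $\{1,\dots,n-1\}$ and $p\mapsto p+1$; $y=x^{-1}$; for $1\le i\le n$, the identity $e_i$ on $\{1,\dots,n\}\setminus\{i\}$; for $1\le i\le m$, the map $x_i$ with domain $\{1,1+i\}$, $1\mapsto 1$, $1+i\mapsto n-i+1$; and $y_i=x_i^{-1}$. Let $A=\{x,y,e_1,\dots,e_n,x_1,\dots,x_m,y_1,\dots,y_m\}$ be an alphabet of letters named after these elements, and let $R$ be the following set of relations between words over $A$ (a product $e_a\cdots e_b$ with increasing consecutive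 indices is the empty word if $b<a$; in particular $e_2\cdots e_ie_{i+2}\cdots e_n$ denotes $(e_2\cdots e_i)(e_{i+2}\cdots e_n)$, and similarly for the other products with one index omitted; a chain $u_1=u_2=\cdots=u_k$ stands for the $k-1$ relations $u_1=u_2,\dots,u_{k-1}=u_k$): - $(R_1)$ $e_i^2=e_i$, for $1\le i\le n$; - $(R_2)$ $xy=e_n$ and $yx=e_1$; - $(R_3)$ $xe_1=x$ and $e_1y=y$; - $(R_4)$ $e_ie_j=e_je_i$, for $1\le i<j\le n$; - $(R_5)$ $e_ix=xe_{i+1}$, for $1\le i\le n-1$; - $(R_6)$ $x_iy_i=e_2\cdots e_ie_{i+2}\cdots e_n$ and $y_ix_i=e_2\cdots e_{n-i}e_{n-i+2}\cdots e_n$, for $1\le i\le m$; - $(R_7)$ $x_ie_j=x_i$ and $e_jy_i=y_i$, for $1\le i\le m$, $2\le j\le n$, $j\ne n-i+1$; - $(R_8)$ $e_jx_i=x_i$ and $y_ie_j=y_i$, for $1\le i\le m$, $2\le j\le n$, $j\ne i+1$; - $(R_9)$ $e_1x_i=x_ie_1=x^{n-2i}e_{n-2i+1}\cdots e_{n-i}e_{n-i+2}\cdots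 e_n$ and $e_1y_i=y_ie_1=y^{n-2i}e_1\cdots e_ie_{i+2}\cdots e_{2i}$, for $1\le i\le m$; - $(R_{10})$ $x_ie_{n-i+1}=e_{i+1}x_i=y_ie_{i+1}=e_{n-i+1}y_i=e_2\cdots e_n$, for $1\le i\le m$; - $(R_{11})$ $xe_2\cdots e_n=e_1\cdots e_n$. Then $\mathcal{ODI}_n$ is defined by the monoid presentation $\langle A\mid R\rangle$: sending each letter to the element of $\mathcal{ODI}_n$ that it names induces an isomorphism of monoids from $A^*/\rho_R$ onto $\mathcal{ODI}_n$, where $\rho_R$ is the smallest congruence on the free monoid $A^*$ containing $R$. Moreover, $$|A|=2n+\frac{1-(-1)^n}{2}\qquad\text{and}\qquad |R|=\frac{5n^2-(1+2(-1)^n)n+(-1)^{n+1}+5}{2}.$$ -/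

import Mathlib

namespace DihedralInverse

/-- The symmetric inverse monoid on the chain `{1 < ⋯ < n}`: all partial permutations.
The underlying chain is `Fin n`, the point `p` of `{1, …, n}` being the element of value `p - 1`. -/
def SymInv (n : ℕ) : Type := Fin n ≃. Fin n

/-- Multiplication is composition from left to right, `p (α * β) = (p α) β`. -/
instance (n : ℕ) : Monoid (SymInv n) where
  mul α β := PEquiv.trans α β
  one := PEquiv.refl (Fin n)
  mul_assoc α β γ := PEquiv.trans_assoc α β γ
  one_mul α := PEquiv.refl_trans α
  mul_one α := PEquiv.trans_refl α

/-- `α.MapsTo p q`: the point `p` lies in the domain of `α` and its image is `q`. -/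
def SymInv.MapsTo {n : ℕ} (α : SymInv n) (p q : Fin n) : Prop :=
  PEquiv.toFun α p = some q

theorem SymInv.one_mapsTo {n : ℕ} {p q : Fin n} :
    (1 : SymInv n).MapsTo p q ↔ p = q := by
  change some p = some q ↔ p = q
  simp

theorem SymInv.mul_mapsTo {n : ℕ} {α β : SymInv n} {p r : Fin n} :
    (α * β).MapsTo p r ↔ ∃ q, α.MapsTo p q ∧ β.MapsTo q r :=
  PEquiv.trans_eq_some α β p r

/-- The dihedral group of order `2n` (for `n ≥ 3`), as the group of permutations generated by
the `n`-cycle `g = (1 2 ⋯ n)` and the reflection `h : p ↦ n + 1 - p`. -/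
def dihedral (n : ℕ) : Subgroup (Equiv.Perm (Fin n)) :=
  Subgroup.closure {finRotate n, Fin.revPerm}

/-- The dihedral inverse monoid: all restrictions of permutations of the dihedral group. -/
def DI (n : ℕ) : Submonoid (SymInv n) where
  carrier := {α | ∃ σ ∈ dihedral n, ∀ p q, α.MapsTo p q → σ p = q}
  one_mem' := ⟨1, one_mem _, fun _ _ h => SymInv.one_mapsTo.1 h⟩
  mul_mem' := by
    rintro α β ⟨σ, hσ, hα⟩ ⟨τ, hτ, hβ⟩
    refine ⟨τ * σ, mul_mem hτ hσ, fun p r h => ?_⟩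
    obtain ⟨q, h1, h2⟩ := SymInv.mul_mapsTo.1 h
    rw [Equiv.Perm.mul_apply, hα p q h1, hβ q r h2]

/-- The monoid of all order-preserving partial permutations. -/
def POI (n : ℕ) : Submonoid (SymInv n) where
  carrier := {α | ∀ p q p' q', α.MapsTo p p' → α.MapsTo q q' → p ≤ q → p' ≤ q'}
  one_mem' := by
    intro p q p' q' hp hq h
    rw [← SymInv.one_mapsTo.1 hp, ← SymInv.one_mapsTo.1 hq]
    exact h
  mul_mem' := by
    intro α β hα hβ p q p' q' hp hq h
    obtain ⟨u, hu, hu'⟩ := SymInv.mul_mapsTo.1 hp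
    obtain ⟨v, hv, hv'⟩ := SymInv.mul_mapsTo.1 hq
    exact hβ u v p' q' hu' hv' (hα p q u v hu hv h)

/-- The monoid of all order-preserving restrictions of elements of the dihedral group. -/
def ODI (n : ℕ) : Submonoid (SymInv n) := DI n ⊓ POI n

/-! ### The distinguished elements -/

/-- The point `p` of `{1, …, n}`. -/
def pt (n p : ℕ) (hp : 1 ≤ p ∧ p ≤ n) : Fin n := ⟨p - 1, by omega⟩

/-- The shift `p ↦ p + 1`, for `1 ≤ p ≤ n - 1`. -/
def shift (n : ℕ) : SymInv n where
  toFun p := if h : p.val + 1 < n then some ⟨p.val + 1, h⟩ else none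
  invFun q := if q.val = 0 then none else some ⟨q.val - 1, by omega⟩
  inv p q := by
    have hp := p.isLt
    have hq := q.isLt
    by_cases h1 : q.val = 0 <;> by_cases h2 : p.val + 1 < n <;>
      simp [h1, h2, Fin.ext_iff] <;> omega

/-- The inverse partial permutation. -/
def SymInv.inverse {n : ℕ} (α : SymInv n) : SymInv n := PEquiv.symm α

/-- The partial identity whose domain is `{1, …, n}` without the point `i`. -/
def idem (n i : ℕ) (hi : 1 ≤ i ∧ i ≤ n) : SymInv n where
  toFun p := if p = pt n i hi then none else some p
  invFun p := if p = pt n i hi then none else some p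
  inv p q := by
    by_cases h1 : p = pt n i hi <;> by_cases h2 : q = pt n i hi <;> simp [h1, h2] <;> grind

/-- The partial permutation of rank `2` with `a ↦ c` and `b ↦ d`, where `a ≠ b` and `c ≠ d`. -/
def twoPoint {n : ℕ} (a b c d : Fin n) (hab : a ≠ b) (hcd : c ≠ d) : SymInv n where
  toFun p := if p = a then some c else if p = b then some d else none
  invFun q := if q = c then some a else if q = d then some b else none
  inv p q := by
    grind

/-- The element `x_i`, with `1 ↦ 1` and `1 + i ↦ n - i + 1`. -/
def xElt (n i : ℕ) (hi : 1 ≤ i ∧ i ≤ (n - 1) / 2) : SymInv n :=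
  twoPoint (pt n 1 (by omega)) (pt n (1 + i) (by omega))
    (pt n 1 (by omega)) (pt n (n - i + 1) (by omega))
    (by simp [pt, Fin.ext_iff]; omega) (by simp [pt, Fin.ext_iff]; omega)

/-! ### The presentation -/

/-- The alphabet `{x, y, e_1, …, e_n, x_1, …, x_m, y_1, …, y_m}` with `m = ⌊(n - 1) / 2⌋`. -/
inductive Letter (n : ℕ) : Type
  | x : Letter n
  | y : Letter n
  | e (i : ℕ) (hi : 1 ≤ i ∧ i ≤ n) : Letter n
  | xs (i : ℕ) (hi : 1 ≤ i ∧ i ≤ (n - 1) / 2) : Letter n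
  | ys (i : ℕ) (hi : 1 ≤ i ∧ i ≤ (n - 1) / 2) : Letter n

/-- The element of the symmetric inverse monoid named by a letter. -/
def Letter.val {n : ℕ} : Letter n → SymInv n
  | .x => shift n
  | .y => (shift n).inverse
  | .e i hi => idem n i hi
  | .xs i hi => xElt n i hi
  | .ys i hi => (xElt n i hi).inverse

section Words

variable {n : ℕ}

/-- The one-letter word `x`. -/
def X : FreeMonoid (Letter n) := FreeMonoid.of Letter.x

/-- The one-letter word `y`. -/
def Y : FreeMonoid (Letter n) := FreeMonoid.of Letter.y

/-- The one-letter word `e_i`. -/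
def E (i : ℕ) (hi : 1 ≤ i ∧ i ≤ n) : FreeMonoid (Letter n) := FreeMonoid.of (Letter.e i hi)

/-- The one-letter word `x_i`. -/
def Xs (i : ℕ) (hi : 1 ≤ i ∧ i ≤ (n - 1) / 2) : FreeMonoid (Letter n) :=
  FreeMonoid.of (Letter.xs i hi)

/-- The one-letter word `y_i`. -/
def Ys (i : ℕ) (hi : 1 ≤ i ∧ i ≤ (n - 1) / 2) : FreeMonoid (Letter n) :=
  FreeMonoid.of (Letter.ys i hi)

/-- The word `e_a e_{a+1} ⋯ e_b`, for `1 ≤ a` and `b ≤ n`; it is empty if `b < a`. -/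
def Eprod (a b : ℕ) : FreeMonoid (Letter n) :=
  (((List.finRange n).filter fun k => a ≤ k.val + 1 ∧ k.val + 1 ≤ b).map
    fun k => E (k.val + 1) ⟨Nat.le_add_left 1 k.val, k.isLt⟩).prod

end Words

/-- The defining relations. A chain `u_1 = u_2 = ⋯ = u_k` stands for the `k - 1` relations
`u_1 = u_2`, …, `u_{k-1} = u_k`. -/
inductive Rel (n : ℕ) : FreeMonoid (Letter n) → FreeMonoid (Letter n) → Prop
  | r1 (i : ℕ) (hi : 1 ≤ i ∧ i ≤ n) : Rel n (E i hi ^ 2) (E i hi)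
  | r2_xy (hn : 1 ≤ n) : Rel n (X * Y) (E n ⟨hn, le_rfl⟩)
  | r2_yx (hn : 1 ≤ n) : Rel n (Y * X) (E 1 ⟨le_rfl, hn⟩)
  | r3_x (hn : 1 ≤ n) : Rel n (X * E 1 ⟨le_rfl, hn⟩) X
  | r3_y (hn : 1 ≤ n) : Rel n (E 1 ⟨le_rfl, hn⟩ * Y) Y
  | r4 (i j : ℕ) (hi : 1 ≤ i) (hij : i < j) (hj : j ≤ n) :
      Rel n (E i (by omega) * E j (by omega)) (E j (by omega) * E i (by omega))
  | r5 (i : ℕ) (h1 : 1 ≤ i) (h2 : i + 1 ≤ n) :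
      Rel n (E i (by omega) * X) (X * E (i + 1) (by omega))
  | r6_xy (i : ℕ) (hi : 1 ≤ i ∧ i ≤ (n - 1) / 2) :
      Rel n (Xs i hi * Ys i hi) (Eprod 2 i * Eprod (i + 2) n)
  | r6_yx (i : ℕ) (hi : 1 ≤ i ∧ i ≤ (n - 1) / 2) :
      Rel n (Ys i hi * Xs i hi) (Eprod 2 (n - i) * Eprod (n - i + 2) n)
  | r7_x (i j : ℕ) (hi : 1 ≤ i ∧ i ≤ (n - 1) / 2) (h1 : 2 ≤ j) (h2 : j ≤ n)
      (hj : j ≠ n - i + 1) : Rel n (Xs i hi * E j (by omega)) (Xs i hi)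
  | r7_y (i j : ℕ) (hi : 1 ≤ i ∧ i ≤ (n - 1) / 2) (h1 : 2 ≤ j) (h2 : j ≤ n)
      (hj : j ≠ n - i + 1) : Rel n (E j (by omega) * Ys i hi) (Ys i hi)
  | r8_x (i j : ℕ) (hi : 1 ≤ i ∧ i ≤ (n - 1) / 2) (h1 : 2 ≤ j) (h2 : j ≤ n)
      (hj : j ≠ i + 1) : Rel n (E j (by omega) * Xs i hi) (Xs i hi)
  | r8_y (i j : ℕ) (hi : 1 ≤ i ∧ i ≤ (n - 1) / 2) (h1 : 2 ≤ j) (h2 : j ≤ n)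
      (hj : j ≠ i + 1) : Rel n (Ys i hi * E j (by omega)) (Ys i hi)
  | r9_x (i : ℕ) (hi : 1 ≤ i ∧ i ≤ (n - 1) / 2) :
      Rel n (E 1 (by omega) * Xs i hi) (Xs i hi * E 1 (by omega))
  | r9_x' (i : ℕ) (hi : 1 ≤ i ∧ i ≤ (n - 1) / 2) :
      Rel n (Xs i hi * E 1 (by omega))
        (X ^ (n - 2 * i) * (Eprod (n - 2 * i + 1) (n - i) * Eprod (n - i + 2) n))
  | r9_y (i : ℕ) (hi : 1 ≤ i ∧ i ≤ (n - 1) / 2) :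
      Rel n (E 1 (by omega) * Ys i hi) (Ys i hi * E 1 (by omega))
  | r9_y' (i : ℕ) (hi : 1 ≤ i ∧ i ≤ (n - 1) / 2) :
      Rel n (Ys i hi * E 1 (by omega))
        (Y ^ (n - 2 * i) * (Eprod 1 i * Eprod (i + 2) (2 * i)))
  | r10_a (i : ℕ) (hi : 1 ≤ i ∧ i ≤ (n - 1) / 2) :
      Rel n (Xs i hi * E (n - i + 1) (by omega)) (E (i + 1) (by omega) * Xs i hi)
  | r10_b (i : ℕ) (hi : 1 ≤ i ∧ i ≤ (n - 1) / 2) :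
      Rel n (E (i + 1) (by omega) * Xs i hi) (Ys i hi * E (i + 1) (by omega))
  | r10_c (i : ℕ) (hi : 1 ≤ i ∧ i ≤ (n - 1) / 2) :
      Rel n (Ys i hi * E (i + 1) (by omega)) (E (n - i + 1) (by omega) * Ys i hi)
  | r10_d (i : ℕ) (hi : 1 ≤ i ∧ i ≤ (n - 1) / 2) :
      Rel n (E (n - i + 1) (by omega) * Ys i hi) (Eprod 2 n)
  | r11 : Rel n (X * Eprod 2 n) (Eprod 1 n)

end DihedralInverse

/-!
The argument is a normal form theorem. Write `z_c` for `x ^ c` if `0 ≤ c` and for `y ^ (-c)` if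
`c < 0`. An element of `ODI n` is of one of two kinds (`ODI_cases`): a restriction of a translation
`p ↦ p + c`, or a map of rank `2` that restricts a reflection and turns the distance `d ≠ n / 2`
between the points of its domain into `n - d`. The former are named by the words `z_c * e(S)`, where
`e(S)` is the product of the `e_i` with `i ∈ S`. The latter are named by `y ^ a * w_d * x ^ b`, where
`w_d` is the letter `x_d` if `d ≤ m` and the letter `y_{n-d}` if `n - d ≤ m`. Indexing the letters of
rank `2` by `d` in this way makes the relations for the `x_i` and the `y_i` instances of the same
statements: `w_d` absorbs `e_j` on the right unless `j = 1` or `j = n - d + 1`, and on the left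
unless `j = 1` or `j = d + 1`, while in the exceptional cases, and in `w_d * w_{n-d}`, the product is
a translation word.

The relations show that the set of these words (`Pres.IsNormal`) is closed under right
multiplication by letters, so that every element of the presented monoid has a normal form
(`Pres.isNormal`). Products of translation words are translation words by the commutation rules of
`x` and `y` with the `e_i`. For words of rank `2`, an exponent `a` or `b` that is too large, or a
letter that does not fit, always produces one of the exceptional products above.

Two normal forms that name the same map are equal in the presented monoid (`Pres.eval_injective`).
For translation words with nonempty domain, `c` is determined, and so is `S` up to indices that are
absorbed by `z_c` (`Pres.mul_cut_congr`); with empty domain both are equal to `e_1 ⋯ e_n`, by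
`x e_2 ⋯ e_n = e_1 ⋯ e_n`. In rank `2` the two points and their images determine `d`, `a` and `b`.

For the number of relations: no two relations have the same left-hand side, so it suffices to count
the left-hand sides (`relLhs_injective`).
-/

namespace DihedralInverse

/-! ### Partial permutations through their graphs -/

theorem SymInv.ext {n : ℕ} {α β : SymInv n} (h : ∀ p q, α.MapsTo p q ↔ β.MapsTo p q) :
    α = β :=
  PEquiv.ext fun p => Option.ext fun q => h p q

theorem SymInv.MapsTo.right_unique {n : ℕ} {α : SymInv n} {p q q' : Fin n}
    (h : α.MapsTo p q) (h' : α.MapsTo p q') : q = q' :=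
  Option.some.inj (h.symm.trans h')

theorem SymInv.MapsTo.left_unique {n : ℕ} {α : SymInv n} {p p' q : Fin n}
    (h : α.MapsTo p q) (h' : α.MapsTo p' q) : p = p' :=
  PEquiv.inj α h h'

theorem SymInv.inverse_mapsTo {n : ℕ} {α : SymInv n} {p q : Fin n} :
    α.inverse.MapsTo p q ↔ α.MapsTo q p :=
  PEquiv.eq_some_iff α

theorem shift_mapsTo {n : ℕ} {p q : Fin n} :
    (shift n).MapsTo p q ↔ q.val = p.val + 1 := by
  have hq := q.isLt
  simp only [SymInv.MapsTo, shift]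
  split_ifs with h
  · simp only [Option.some.injEq, Fin.ext_iff]
    omega
  · simp
    omega

theorem idem_mapsTo {n i : ℕ} {hi : 1 ≤ i ∧ i ≤ n} {p q : Fin n} :
    (idem n i hi).MapsTo p q ↔ p = q ∧ q.val + 1 ≠ i := by
  have : p = pt n i hi ↔ p.val + 1 = i := by
    simp only [pt, Fin.ext_iff]
    omega
  simp only [SymInv.MapsTo, idem, this]
  split_ifs with h
  · simp only [false_iff, not_and, not_not]
    rintro rfl
    exact h
  · simp only [Option.some.injEq]
    grind

theorem twoPoint_mapsTo {n : ℕ} {a b c d : Fin n} {hab : a ≠ b} {hcd : c ≠ d} {p q : Fin n} :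
    (twoPoint a b c d hab hcd).MapsTo p q ↔ p = a ∧ q = c ∨ p = b ∧ q = d := by
  simp only [SymInv.MapsTo, twoPoint]
  grind

theorem xElt_mapsTo {n i : ℕ} {hi : 1 ≤ i ∧ i ≤ (n - 1) / 2} {p q : Fin n} :
    (xElt n i hi).MapsTo p q ↔
      p.val = 0 ∧ q.val = 0 ∨ p.val = i ∧ q.val = n - i := by
  simp only [xElt, twoPoint_mapsTo, pt, Fin.ext_iff]
  omega

theorem shift_pow_mapsTo {n k : ℕ} {p q : Fin n} :
    (shift n ^ k).MapsTo p q ↔ q.val = p.val + k := by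
  induction k generalizing q with
  | zero => rw [pow_zero, SymInv.one_mapsTo, Fin.ext_iff]; omega
  | succ k ih =>
    rw [pow_succ, SymInv.mul_mapsTo]
    simp only [ih, shift_mapsTo]
    constructor
    · rintro ⟨r, h1, h2⟩
      omega
    · intro h
      exact ⟨⟨p.val + k, by omega⟩, rfl, by simp only; omega⟩

theorem shift_inverse_pow_mapsTo {n k : ℕ} {p q : Fin n} :
    ((shift n).inverse ^ k).MapsTo p q ↔ p.val = q.val + k := by
  induction k generalizing q with
  | zero => rw [pow_zero, SymInv.one_mapsTo, Fin.ext_iff]; omega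
  | succ k ih =>
    rw [pow_succ, SymInv.mul_mapsTo]
    simp only [ih, SymInv.inverse_mapsTo, shift_mapsTo]
    constructor
    · rintro ⟨r, h1, h2⟩
      omega
    · intro h
      exact ⟨⟨q.val + 1, by omega⟩, by simp only; omega, rfl⟩

theorem lift_Eprod_mapsTo {n a b : ℕ} {p q : Fin n} :
    (FreeMonoid.lift Letter.val (Eprod (n := n) a b)).MapsTo p q ↔
      p = q ∧ ¬ (a ≤ q.val + 1 ∧ q.val + 1 ≤ b) := by
  have key : ∀ L : List (Fin n),
      (FreeMonoid.lift Letter.val (L.map fun k : Fin n =>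
        E (k.val + 1) ⟨Nat.le_add_left 1 k.val, k.isLt⟩).prod).MapsTo p q ↔ p = q ∧ q ∉ L := by
    intro L
    induction L generalizing p with
    | nil => simp [SymInv.one_mapsTo]
    | cons k L ih =>
      simp only [List.map_cons, List.prod_cons, map_mul, SymInv.mul_mapsTo, E,
        FreeMonoid.lift_eval_of, Letter.val, idem_mapsTo, List.mem_cons]
      simp only [E] at ih
      simp only [ih]
      grind
  rw [Eprod, key]
  simp

theorem idem_mul_mapsTo {n i : ℕ} {hi : 1 ≤ i ∧ i ≤ n} {α : SymInv n} {p q : Fin n} :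
    (idem n i hi * α).MapsTo p q ↔ p.val + 1 ≠ i ∧ α.MapsTo p q := by
  simp only [SymInv.mul_mapsTo, idem_mapsTo]
  grind

theorem mul_idem_mapsTo {n i : ℕ} {hi : 1 ≤ i ∧ i ≤ n} {α : SymInv n} {p q : Fin n} :
    (α * idem n i hi).MapsTo p q ↔ α.MapsTo p q ∧ q.val + 1 ≠ i := by
  simp only [SymInv.mul_mapsTo, idem_mapsTo]
  grind

theorem mul_lift_Eprod_mapsTo {n a b : ℕ} {α : SymInv n} {p q : Fin n} :
    (α * FreeMonoid.lift Letter.val (Eprod (n := n) a b)).MapsTo p q ↔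
      α.MapsTo p q ∧ ¬ (a ≤ q.val + 1 ∧ q.val + 1 ≤ b) := by
  simp only [SymInv.mul_mapsTo, lift_Eprod_mapsTo]
  grind

/-! ### The monoid of order-preserving restrictions of dihedral permutations -/

/-- The relations between the generators hold for the partial permutations that they name. -/
theorem lift_val_eq_of_rel {n : ℕ} (hn : 4 ≤ n) {u v : FreeMonoid (Letter n)} (h : Rel n u v) :
    FreeMonoid.lift Letter.val u = FreeMonoid.lift Letter.val v := by
  apply SymInv.ext
  intro p q
  have hp := p.isLt
  have hq := q.isLt
  cases h
  all_goals
    simp only [map_mul, map_pow, pow_two, ← mul_assoc, E, X, Y, Xs, Ys, FreeMonoid.lift_eval_of,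
      Letter.val, idem_mul_mapsTo, mul_idem_mapsTo, mul_lift_Eprod_mapsTo]
    simp only [SymInv.mul_mapsTo, idem_mapsTo, shift_mapsTo, xElt_mapsTo, SymInv.inverse_mapsTo,
      lift_Eprod_mapsTo, shift_pow_mapsTo, shift_inverse_pow_mapsTo, Fin.ext_iff, Fin.exists_iff]
  case r2_xy =>
    constructor
    · rintro ⟨r, hr, h⟩
      omega
    · intro h
      exact ⟨p.val + 1, by omega, by omega, by omega⟩
  case r2_yx =>
    constructor
    · rintro ⟨r, hr, h⟩
      omega
    · intro h
      exact ⟨p.val - 1, by omega, by omega, by omega⟩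
  case r6_xy i hi =>
    constructor
    · rintro ⟨r, hr, h⟩
      omega
    · intro h
      by_cases h0 : p.val = 0
      · exact ⟨0, by omega, by omega, by omega⟩
      · exact ⟨n - i, by omega, by omega, by omega⟩
  case r6_yx i hi =>
    constructor
    · rintro ⟨r, hr, h⟩
      omega
    · intro h
      by_cases h0 : p.val = 0
      · exact ⟨0, by omega, by omega, by omega⟩
      · exact ⟨i, by omega, by omega, by omega⟩
  all_goals omega

/-- A permutation of `Fin n` in the dihedral group is a rotation or a reflection. -/
theorem dihedral_cases {n : ℕ} {σ : Equiv.Perm (Fin n)} (hσ : σ ∈ dihedral n) :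
    (∃ c : ℤ, ∀ p, ((σ p : ℕ) : ℤ) ≡ (p : ℕ) + c [ZMOD n]) ∨
      ∃ c : ℤ, ∀ p, ((σ p : ℕ) : ℤ) ≡ c - (p : ℕ) [ZMOD n] := by
  induction hσ using Subgroup.closure_induction with
  | mem σ h =>
    rcases h with rfl | rfl
    · refine Or.inl ⟨1, fun p => ?_⟩
      rcases n with _ | n
      · exact p.elim0
      · rw [finRotate_apply, Fin.val_add_one]
        split_ifs with h
        · subst h
          simp [Int.modEq_iff_dvd]
        · push_cast
          rfl
    · refine Or.inr ⟨n - 1, fun p => ?_⟩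
      have := p.isLt
      rw [Fin.revPerm_apply, Fin.val_rev]
      have : ((n - (p.val + 1) : ℕ) : ℤ) = n - 1 - p.val := by omega
      rw [this]
  | one => exact Or.inl ⟨0, fun p => by simp⟩
  | mul σ τ _ _ hσ hτ =>
    simp only [Equiv.Perm.mul_apply]
    rcases hσ with ⟨c, hσ⟩ | ⟨c, hσ⟩ <;> rcases hτ with ⟨d, hτ⟩ | ⟨d, hτ⟩
    · refine Or.inl ⟨d + c, fun p => (hσ _).trans ?_⟩
      simpa [add_assoc] using (hτ p).add_right c
    · refine Or.inr ⟨d + c, fun p => (hσ _).trans ?_⟩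
      have := (hτ p).add_right c
      rwa [sub_add_eq_add_sub] at this
    · refine Or.inr ⟨c - d, fun p => (hσ _).trans ?_⟩
      have := (hτ p).sub_left c
      rwa [← sub_sub, sub_right_comm] at this
    · refine Or.inl ⟨c - d, fun p => (hσ _).trans ?_⟩
      have := (hτ p).sub_left c
      rwa [← sub_add, add_comm] at this
  | inv σ _ hσ =>
    rcases hσ with ⟨c, hσ⟩ | ⟨c, hσ⟩
    · refine Or.inl ⟨-c, fun p => ?_⟩
      have := ((hσ (σ⁻¹ p)).add_right (-c)).symm
      rw [← Equiv.Perm.mul_apply, mul_inv_cancel, Equiv.Perm.one_apply] at this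
      simpa using this
    · refine Or.inr ⟨c, fun p => ?_⟩
      have := ((hσ (σ⁻¹ p)).sub_left c).symm
      rw [← Equiv.Perm.mul_apply, mul_inv_cancel, Equiv.Perm.one_apply] at this
      simpa using this

/-- An element of `ODI n` either moves all points of its domain by the same amount, or has rank `2`
and turns the distance `d` between the two points of its domain into `n - d`. -/
theorem ODI_cases {n : ℕ} {α : SymInv n} (hα : α ∈ ODI n) :
    (∃ c : ℤ, ∀ p q, α.MapsTo p q → ((q : ℕ) : ℤ) = (p : ℕ) + c) ∨
      ∃ a d b : ℕ, 0 < d ∧ a + d < n ∧ b + (n - d) < n ∧ 2 * d ≠ n ∧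
        ∀ p q, α.MapsTo p q ↔ p.val = a ∧ q.val = b ∨ p.val = a + d ∧ q.val = b + (n - d) := by
  obtain ⟨⟨σ, hσ, hασ⟩, hmono⟩ := hα
  -- two points in the domain keep their order, and their images differ
  have hlt : ∀ p q p' q', α.MapsTo p p' → α.MapsTo q q' → p.val < q.val → p'.val < q'.val := by
    intro p q p' q' hp hq h
    refine lt_of_le_of_ne (hmono p q p' q' hp hq h.le) fun h' => ?_
    have : p = q := hp.left_unique (Fin.ext h' ▸ hq)
    exact h.ne (congrArg Fin.val this)
  -- an integer divisible by `n` and strictly between `-n` and `2n` is `0` or `n`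
  have hdvd : ∀ z : ℤ, (n : ℤ) ∣ z → -n < z → z < 2 * n → z = 0 ∨ z = n := by
    rintro z ⟨k, rfl⟩ h1 h2
    have : -1 < k := by nlinarith
    have : k < 2 := by nlinarith
    obtain rfl | rfl : k = 0 ∨ k = 1 := by omega
    · simp
    · simp
  by_cases hne : ∃ p p', α.MapsTo p p'
  swap
  · exact Or.inl ⟨0, fun p q h => (hne ⟨p, q, h⟩).elim⟩
  rcases dihedral_cases hσ with ⟨c, hc⟩ | ⟨c, hc⟩
  · left
    have key : ∀ p q p' q', α.MapsTo p p' → α.MapsTo q q' → p.val < q.val →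
        ((q' : ℕ) : ℤ) - q = (p' : ℕ) - (p : ℕ) := by
      intro p q p' q' hp hq h
      have h1 := hlt p q p' q' hp hq h
      have h2 := ((hc q).sub (hc p)).dvd
      rw [hασ p p' hp, hασ q q' hq] at h2
      have := hdvd _ h2 (by omega) (by omega)
      omega
    obtain ⟨p, p', hp⟩ := hne
    refine ⟨p' - p, fun q q' hq => ?_⟩
    rcases lt_trichotomy p.val q.val with h | h | h
    · have := key p q p' q' hp hq h
      omega
    · obtain rfl := Fin.ext h
      obtain rfl := hp.right_unique hq
      omega
    · have := key q p q' p' hq hp h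
      omega
  · have key : ∀ p q p' q', α.MapsTo p p' → α.MapsTo q q' → p.val < q.val →
        q'.val = p'.val + (n - (q.val - p.val)) := by
      intro p q p' q' hp hq h
      have h1 := hlt p q p' q' hp hq h
      have h2 := ((hc p).sub (hc q)).dvd
      rw [hασ p p' hp, hασ q q' hq] at h2
      have := hdvd _ h2 (by omega) (by omega)
      omega
    by_cases h2 : ∃ p q p' q', α.MapsTo p p' ∧ α.MapsTo q q' ∧ p.val < q.val
    · obtain ⟨p, q, p', q', hp, hq, h⟩ := h2
      have hpq := key p q p' q' hp hq h
      -- three points would give `n = 2n`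
      have hdom : ∀ r r', α.MapsTo r r' → r = p ∨ r = q := by
        intro r r' hr
        by_contra! hr'
        have h1 : r.val ≠ p.val := fun h => hr'.1 (Fin.ext h)
        have h2 : r.val ≠ q.val := fun h => hr'.2 (Fin.ext h)
        have k1 := key r p r' p' hr hp
        have k2 := key p r p' r' hp hr
        have k3 := key r q r' q' hr hq
        have k4 := key q r q' r' hq hr
        omega
      have hmap : ∀ r s, α.MapsTo r s ↔
          r.val = p.val ∧ s.val = p'.val ∨ r.val = q.val ∧ s.val = q'.val := by
        intro r s
        simp only [← Fin.ext_iff]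
        constructor
        · intro hr
          rcases hdom r s hr with rfl | rfl
          · exact Or.inl ⟨rfl, hr.right_unique hp⟩
          · exact Or.inr ⟨rfl, hr.right_unique hq⟩
        · rintro (⟨rfl, rfl⟩ | ⟨rfl, rfl⟩)
          · exact hp
          · exact hq
      by_cases hn : 2 * (q.val - p.val) = n
      · left
        refine ⟨p' - p, fun r s hr => ?_⟩
        have := (hmap r s).1 hr
        omega
      · right
        refine ⟨p, q - p, p', by omega, by omega, by omega, hn, fun r s => ?_⟩
        rw [hmap]
        omega
    · left
      obtain ⟨p, p', hp⟩ := hne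
      refine ⟨p' - p, fun q q' hq => ?_⟩
      rcases lt_trichotomy p.val q.val with h | h | h
      · exact (h2 ⟨p, q, p', q', hp, hq, h⟩).elim
      · obtain rfl := Fin.ext h
        obtain rfl := hp.right_unique hq
        omega
      · exact (h2 ⟨q, p, q', p', hq, hp, h⟩).elim

theorem SymInv.inverse_mem_ODI {n : ℕ} {α : SymInv n} (hα : α ∈ ODI n) : α.inverse ∈ ODI n := by
  obtain ⟨⟨σ, hσ, hασ⟩, hmono⟩ := hα
  refine ⟨⟨σ⁻¹, inv_mem hσ, fun p q h => ?_⟩, fun p q p' q' hp hq h => ?_⟩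
  · rw [Equiv.Perm.inv_eq_iff_eq, hασ q p (SymInv.inverse_mapsTo.1 h)]
  · rw [SymInv.inverse_mapsTo] at hp hq
    by_contra! h'
    have := hmono q' p' q p hq hp h'.le
    obtain rfl := le_antisymm h this
    exact h'.ne (hq.left_unique hp)

theorem shift_mem_ODI (n : ℕ) : shift n ∈ ODI n := by
  refine ⟨⟨finRotate n, Subgroup.subset_closure (by simp), fun p q h => ?_⟩,
    fun p q p' q' hp hq h => ?_⟩
  · rw [shift_mapsTo] at h
    rcases n with _ | n
    · exact p.elim0
    · apply Fin.ext
      rw [finRotate_apply, Fin.val_add_one_of_lt, h]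
      rw [Fin.lt_def, Fin.val_last]
      omega
  · rw [shift_mapsTo] at hp hq
    rw [Fin.le_def] at h ⊢
    omega

theorem idem_mem_ODI (n i : ℕ) (hi : 1 ≤ i ∧ i ≤ n) : idem n i hi ∈ ODI n := by
  refine ⟨⟨1, one_mem _, fun p q h => (idem_mapsTo.1 h).1⟩, fun p q p' q' hp hq h => ?_⟩
  rwa [← (idem_mapsTo.1 hp).1, ← (idem_mapsTo.1 hq).1]

theorem xElt_mem_ODI (n i : ℕ) (hi : 1 ≤ i ∧ i ≤ (n - 1) / 2) : xElt n i hi ∈ ODI n := by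
  refine ⟨⟨finRotate n * Fin.revPerm, mul_mem (Subgroup.subset_closure (by simp))
    (Subgroup.subset_closure (by simp)), fun p q h => ?_⟩, fun p q p' q' hp hq h => ?_⟩
  · rw [xElt_mapsTo] at h
    rcases n with _ | n
    · exact p.elim0
    · apply Fin.ext
      rw [Equiv.Perm.mul_apply, finRotate_apply, Fin.val_add_one, Fin.revPerm_apply,
        Fin.val_rev]
      split_ifs with h0
      all_goals
        rw [Fin.ext_iff, Fin.val_rev, Fin.val_last] at h0
        omega
  · rw [xElt_mapsTo] at hp hq
    rw [Fin.le_def] at h ⊢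
    omega

theorem Letter.val_mem_ODI {n : ℕ} : ∀ a : Letter n, a.val ∈ ODI n
  | .x => shift_mem_ODI n
  | .y => SymInv.inverse_mem_ODI (shift_mem_ODI n)
  | .e i hi => idem_mem_ODI n i hi
  | .xs i hi => xElt_mem_ODI n i hi
  | .ys i hi => SymInv.inverse_mem_ODI (xElt_mem_ODI n i hi)

/-! ### The generators of the presented monoid -/

/-- The monoid defined by the presentation. -/
abbrev Pres (n : ℕ) : Type := PresentedMonoid (Rel n)

namespace Pres

/-- The class of a word. -/
abbrev cl (n : ℕ) : FreeMonoid (Letter n) →* Pres n := PresentedMonoid.mk (Rel n)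

/-- The class of the letter `x`. -/
def x (n : ℕ) : Pres n := cl n X

/-- The class of the letter `y`. -/
def y (n : ℕ) : Pres n := cl n Y

/-- The class of the letter `e_i`, with the value `1` for an index outside `{1, …, n}`. -/
def e (n i : ℕ) : Pres n := if hi : 1 ≤ i ∧ i ≤ n then cl n (E i hi) else 1

/-- The letters of rank `2`, indexed by the distance `d` between the two points of the domain:
`x_d` if `d ≤ m`, and `y_{n-d}` if `n - d ≤ m`. The value is `1` for the other `d`, that is, for
`d = 0`, for `d ≥ n` and for `2 * d = n`. -/
def w (n d : ℕ) : Pres n :=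
  if h : 1 ≤ d ∧ d ≤ (n - 1) / 2 then cl n (Xs d h)
  else if h : 1 ≤ n - d ∧ n - d ≤ (n - 1) / 2 then cl n (Ys (n - d) h)
  else 1

variable {n : ℕ}

theorem cl_eq {u v : FreeMonoid (Letter n)} (h : Rel n u v) : cl n u = cl n v :=
  PresentedMonoid.mk_eq_mk_of_rel h

theorem cl_E {i : ℕ} (hi : 1 ≤ i ∧ i ≤ n) : cl n (E i hi) = e n i := by
  rw [e, dif_pos hi]

theorem e_of_not {i : ℕ} (hi : ¬ (1 ≤ i ∧ i ≤ n)) : e n i = 1 := dif_neg hi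

theorem cl_Xs {i : ℕ} (hi : 1 ≤ i ∧ i ≤ (n - 1) / 2) : cl n (Xs i hi) = w n i := by
  rw [w, dif_pos hi]

theorem cl_Ys {i : ℕ} (hi : 1 ≤ i ∧ i ≤ (n - 1) / 2) : cl n (Ys i hi) = w n (n - i) := by
  have h1 : ¬ (1 ≤ n - i ∧ n - i ≤ (n - 1) / 2) := by omega
  have h2 : n - (n - i) = i := by omega
  simp only [w, dif_neg h1, h2, dif_pos hi]

theorem e_mul_self (i : ℕ) : e n i * e n i = e n i := by
  by_cases hi : 1 ≤ i ∧ i ≤ n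
  · rw [← cl_E hi, ← map_mul, ← pow_two]
    exact cl_eq (Rel.r1 i hi)
  · rw [e_of_not hi, mul_one]

theorem e_comm (i j : ℕ) : Commute (e n i) (e n j) := by
  by_cases hi : 1 ≤ i ∧ i ≤ n
  swap
  · rw [e_of_not hi]
    exact Commute.one_left _
  by_cases hj : 1 ≤ j ∧ j ≤ n
  swap
  · rw [e_of_not hj]
    exact Commute.one_right _
  rw [← cl_E hi, ← cl_E hj]
  rcases lt_trichotomy i j with h | rfl | h
  · have := cl_eq (Rel.r4 i j hi.1 h hj.2)
    rwa [map_mul, map_mul] at this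
  · exact Commute.refl _
  · have := cl_eq (Rel.r4 j i hj.1 h hi.2)
    rw [map_mul, map_mul] at this
    exact this.symm

theorem x_mul_y (hn : 1 ≤ n) : x n * y n = e n n := by
  rw [x, y, ← map_mul, cl_eq (Rel.r2_xy hn), cl_E]

theorem y_mul_x (hn : 1 ≤ n) : y n * x n = e n 1 := by
  rw [x, y, ← map_mul, cl_eq (Rel.r2_yx hn), cl_E]

theorem x_mul_e_one (hn : 1 ≤ n) : x n * e n 1 = x n := by
  rw [x, ← cl_E ⟨le_rfl, hn⟩, ← map_mul, cl_eq (Rel.r3_x hn)]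

theorem e_one_mul_y (hn : 1 ≤ n) : e n 1 * y n = y n := by
  rw [y, ← cl_E ⟨le_rfl, hn⟩, ← map_mul, cl_eq (Rel.r3_y hn)]

theorem e_last_mul_x (hn : 1 ≤ n) : e n n * x n = x n := by
  rw [← x_mul_y hn, mul_assoc, y_mul_x hn, x_mul_e_one hn]

theorem y_mul_e_last (hn : 1 ≤ n) : y n * e n n = y n := by
  rw [← x_mul_y hn, ← mul_assoc, y_mul_x hn, e_one_mul_y hn]

theorem e_mul_x {i : ℕ} (h1 : 1 ≤ i) (h2 : i < n) : e n i * x n = x n * e n (i + 1) := by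
  rw [x, ← cl_E ⟨h1, h2.le⟩, ← cl_E ⟨by omega, h2⟩, ← map_mul, ← map_mul,
    cl_eq (Rel.r5 i h1 h2)]

theorem y_mul_e {i : ℕ} (h1 : 1 ≤ i) (h2 : i < n) : y n * e n i = e n (i + 1) * y n := by
  have hn : 1 ≤ n := by omega
  calc y n * e n i = y n * (e n n * e n i) := by rw [← mul_assoc, y_mul_e_last hn]
    _ = y n * (e n i * x n) * y n := by
      rw [(e_comm n i).eq, ← x_mul_y hn]
      simp only [mul_assoc]
    _ = e n (i + 1) * e n 1 * y n := by
      rw [e_mul_x h1 h2, ← mul_assoc, y_mul_x hn, (e_comm 1 (i + 1)).eq]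
    _ = e n (i + 1) * y n := by rw [mul_assoc, e_one_mul_y hn]

theorem x_pow_mul_e {k j : ℕ} (hj : j ≤ k) (hn : 1 ≤ n) : x n ^ k * e n j = x n ^ k := by
  induction k generalizing j with
  | zero => rw [e_of_not (by omega), mul_one]
  | succ k ih =>
    by_cases hjn : 1 ≤ j ∧ j ≤ n
    swap
    · rw [e_of_not hjn, mul_one]
    obtain ⟨i, rfl⟩ : ∃ i, j = i + 1 := ⟨j - 1, by omega⟩
    rcases Nat.eq_zero_or_pos i with rfl | hi
    · rw [pow_succ, mul_assoc, x_mul_e_one hn]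
    · rw [pow_succ, mul_assoc, ← e_mul_x hi (by omega), ← mul_assoc, ih (by omega)]

theorem y_pow_mul_e {k j : ℕ} (hj : n + 1 ≤ j + k) (hn : 1 ≤ n) : y n ^ k * e n j = y n ^ k := by
  induction k generalizing j with
  | zero => rw [e_of_not (by omega), mul_one]
  | succ k ih =>
    by_cases hjn : 1 ≤ j ∧ j ≤ n
    swap
    · rw [e_of_not hjn, mul_one]
    rcases hjn.2.eq_or_lt with rfl | hlt
    · rw [pow_succ, mul_assoc, y_mul_e_last hn]
    · rw [pow_succ, mul_assoc, y_mul_e hjn.1 hlt, ← mul_assoc, ih (by omega)]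

theorem e_mul_x_pow {k j : ℕ} (hj : n + 1 ≤ j + k) (hn : 1 ≤ n) : e n j * x n ^ k = x n ^ k := by
  induction k generalizing j with
  | zero => rw [e_of_not (by omega), one_mul]
  | succ k ih =>
    by_cases hjn : 1 ≤ j ∧ j ≤ n
    swap
    · rw [e_of_not hjn, one_mul]
    rcases hjn.2.eq_or_lt with rfl | hlt
    · rw [pow_succ', ← mul_assoc, e_last_mul_x hn]
    · rw [pow_succ', ← mul_assoc, e_mul_x hjn.1 hlt, mul_assoc, ih (by omega)]

/-! ### Products of the idempotents -/

theorem e_pairwise_commute (S : Set ℕ) : S.Pairwise (Function.onFun Commute (e n)) :=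
  fun i _ j _ _ => e_comm i j

/-- The product of the idempotents `e_i` with `i ∈ S`. -/
def cut (n : ℕ) (S : Finset ℕ) : Pres n := S.noncommProd (e n) (e_pairwise_commute _)

theorem cut_empty : cut n ∅ = 1 := Finset.noncommProd_empty _ _

theorem cut_insert (j : ℕ) (S : Finset ℕ) : cut n (insert j S) = e n j * cut n S := by
  by_cases hj : j ∈ S
  · rw [Finset.insert_eq_of_mem hj, ← Finset.insert_erase hj, cut,
      Finset.noncommProd_insert_of_notMem _ _ _ _ (Finset.notMem_erase j S), ← mul_assoc,
      e_mul_self]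
  · rw [cut, Finset.noncommProd_insert_of_notMem _ _ _ _ hj, cut]

theorem e_mul_cut (j : ℕ) (S : Finset ℕ) : e n j * cut n S = cut n S * e n j :=
  Finset.noncommProd_commute _ _ _ _ fun i _ => e_comm j i

theorem cut_union (S T : Finset ℕ) : cut n (S ∪ T) = cut n S * cut n T := by
  induction S using Finset.induction_on with
  | empty => rw [Finset.empty_union, cut_empty, one_mul]
  | insert j S _ ih => rw [Finset.insert_union, cut_insert, cut_insert, ih, mul_assoc]

theorem mul_cut_of_mul_e {u : Pres n} {S : Finset ℕ} (h : ∀ j ∈ S, u * e n j = u) :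
    u * cut n S = u := by
  induction S using Finset.induction_on with
  | empty => rw [cut_empty, mul_one]
  | insert j S _ ih =>
    rw [cut_insert, ← mul_assoc, h j (Finset.mem_insert_self j S),
      ih fun i hi => h i (Finset.mem_insert_of_mem hi)]

/-- The product `u * cut n S` depends only on the indices `j ∈ S` for which `e_j` is not absorbed
by `u`. -/
theorem mul_cut_congr {u : Pres n} {S T : Finset ℕ}
    (h : ∀ j, u * e n j = u ∨ (j ∈ S ↔ j ∈ T)) : u * cut n S = u * cut n T := by
  have key : ∀ S T : Finset ℕ, (∀ j, u * e n j = u ∨ (j ∈ S ↔ j ∈ T)) →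
      u * cut n S = u * cut n (T ∪ S) := by
    intro S T h
    rw [← Finset.sdiff_union_self_eq_union, cut_union, ← mul_assoc,
      mul_cut_of_mul_e (S := T \ S)]
    intro j hj
    rw [Finset.mem_sdiff] at hj
    exact (h j).resolve_right (by tauto)
  rw [key S T h, key T S fun j => (h j).imp_right Iff.symm, Finset.union_comm]

theorem cl_Eprod (a b : ℕ) (ha : 1 ≤ a) (hb : b ≤ n) :
    cl n (Eprod a b) = cut n (Finset.Icc a b) := by
  have key : ∀ L : List (Fin n), cl n (L.map fun k : Fin n =>
      E (k.val + 1) ⟨Nat.le_add_left 1 k.val, k.isLt⟩).prod =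
        cut n (L.map fun k => k.val + 1).toFinset := by
    intro L
    induction L with
    | nil => simp [cut_empty]
    | cons k L ih =>
      rw [List.map_cons, List.prod_cons, map_mul, ih, List.map_cons, List.toFinset_cons,
        cut_insert, cl_E]
  rw [Eprod, key]
  congr 1
  ext j
  simp only [List.mem_toFinset, List.mem_map, List.mem_filter, List.mem_finRange, true_and,
    decide_eq_true_eq, Finset.mem_Icc]
  constructor
  · rintro ⟨k, hk, rfl⟩
    exact hk
  · intro hj
    exact ⟨⟨j - 1, by omega⟩, by simp only; omega, by simp only; omega⟩

/-! ### The submonoid generated by `x`, `y` and the idempotents -/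

/-- The words `x ^ k * cut n S` and `y ^ k * cut n S`, which name the elements that move all points
of their domain by the same amount. -/
def IsTranslation (u : Pres n) : Prop :=
  ∃ (k : ℕ) (S : Finset ℕ), u = x n ^ k * cut n S ∨ u = y n ^ k * cut n S

theorem IsTranslation.mul_e {u : Pres n} (hu : IsTranslation u) (j : ℕ) :
    IsTranslation (u * e n j) := by
  obtain ⟨k, S, rfl | rfl⟩ := hu
  · exact ⟨k, insert j S, Or.inl (by rw [mul_assoc, cut_insert, e_mul_cut])⟩
  · exact ⟨k, insert j S, Or.inr (by rw [mul_assoc, cut_insert, e_mul_cut])⟩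

theorem IsTranslation.mul_cut {u : Pres n} (hu : IsTranslation u) (S : Finset ℕ) :
    IsTranslation (u * cut n S) := by
  induction S using Finset.induction_on generalizing u with
  | empty => rwa [cut_empty, mul_one]
  | insert j S _ ih =>
    rw [cut_insert, ← mul_assoc]
    exact ih (hu.mul_e j)

theorem isTranslation_one : IsTranslation (1 : Pres n) :=
  ⟨0, ∅, Or.inl (by rw [pow_zero, cut_empty, mul_one])⟩

theorem isTranslation_x_pow (k : ℕ) : IsTranslation (x n ^ k) :=
  ⟨k, ∅, Or.inl (by rw [cut_empty, mul_one])⟩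

theorem isTranslation_y_pow (k : ℕ) : IsTranslation (y n ^ k) :=
  ⟨k, ∅, Or.inr (by rw [cut_empty, mul_one])⟩

theorem isTranslation_cut (S : Finset ℕ) : IsTranslation (cut n S) :=
  ⟨0, S, Or.inl (by rw [pow_zero, one_mul])⟩

theorem exists_cut_mul_x (S : Finset ℕ) : ∃ T, cut n S * x n = x n * cut n T := by
  induction S using Finset.induction_on with
  | empty => exact ⟨∅, by rw [cut_empty, one_mul, mul_one]⟩
  | insert j S _ ih =>
    obtain ⟨T, hT⟩ := ih
    by_cases hj : 1 ≤ j ∧ j ≤ n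
    swap
    · exact ⟨T, by rw [cut_insert, e_of_not hj, one_mul, hT]⟩
    rcases hj.2.eq_or_lt with rfl | hlt
    · exact ⟨T, by rw [cut_insert, mul_assoc, hT, ← mul_assoc, e_last_mul_x hj.1]⟩
    · exact ⟨insert (j + 1) T, by
        rw [cut_insert, mul_assoc, hT, ← mul_assoc, e_mul_x hj.1 hlt, mul_assoc, cut_insert]⟩

theorem exists_cut_mul_y (S : Finset ℕ) : ∃ T, cut n S * y n = y n * cut n T := by
  induction S using Finset.induction_on with
  | empty => exact ⟨∅, by rw [cut_empty, one_mul, mul_one]⟩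
  | insert j S _ ih =>
    obtain ⟨T, hT⟩ := ih
    by_cases hj : 1 ≤ j ∧ j ≤ n
    swap
    · exact ⟨T, by rw [cut_insert, e_of_not hj, one_mul, hT]⟩
    obtain ⟨i, rfl⟩ : ∃ i, j = i + 1 := ⟨j - 1, by omega⟩
    rcases Nat.eq_zero_or_pos i with rfl | hi
    · exact ⟨T, by rw [cut_insert, mul_assoc, hT, ← mul_assoc, e_one_mul_y hj.2]⟩
    · exact ⟨insert i T, by
        rw [cut_insert, mul_assoc, hT, ← mul_assoc, ← y_mul_e hi (by omega), mul_assoc,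
          cut_insert]⟩

theorem IsTranslation.mul_x {u : Pres n} (hu : IsTranslation u) (hn : 1 ≤ n) :
    IsTranslation (u * x n) := by
  obtain ⟨k, S, rfl | rfl⟩ := hu <;> obtain ⟨T, hT⟩ := exists_cut_mul_x (n := n) S <;>
    rw [mul_assoc, hT, ← mul_assoc] <;> apply IsTranslation.mul_cut
  · rw [← pow_succ]
    exact isTranslation_x_pow _
  · rcases k with _ | k
    · rw [pow_zero, one_mul, ← pow_one (x n)]
      exact isTranslation_x_pow _
    · rw [pow_succ, mul_assoc, y_mul_x hn]
      exact (isTranslation_y_pow k).mul_e 1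

theorem IsTranslation.mul_y {u : Pres n} (hu : IsTranslation u) (hn : 1 ≤ n) :
    IsTranslation (u * y n) := by
  obtain ⟨k, S, rfl | rfl⟩ := hu <;> obtain ⟨T, hT⟩ := exists_cut_mul_y (n := n) S <;>
    rw [mul_assoc, hT, ← mul_assoc] <;> apply IsTranslation.mul_cut
  · rcases k with _ | k
    · rw [pow_zero, one_mul, ← pow_one (y n)]
      exact isTranslation_y_pow _
    · rw [pow_succ, mul_assoc, x_mul_y hn]
      exact (isTranslation_x_pow k).mul_e n
  · rw [← pow_succ]
    exact isTranslation_y_pow _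

/-- A property that is preserved by right multiplication with `x`, `y` and the `e_j` is preserved
by right multiplication with a translation. -/
theorem IsTranslation.mul_induction {P : Pres n → Prop} (hx : ∀ u, P u → P (u * x n))
    (hy : ∀ u, P u → P (u * y n)) (he : ∀ u j, P u → P (u * e n j)) {u v : Pres n} (hu : P u)
    (hv : IsTranslation v) : P (u * v) := by
  have hcut : ∀ (S : Finset ℕ) u, P u → P (u * cut n S) := by
    intro S
    induction S using Finset.induction_on with
    | empty => intro u hu; rwa [cut_empty, mul_one]
    | insert j S _ ih =>
      intro u hu
      rw [cut_insert, ← mul_assoc]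
      exact ih _ (he u j hu)
  have hpow : ∀ g : Pres n, (∀ u, P u → P (u * g)) → ∀ k u, P u → P (u * g ^ k) := by
    intro g hg k
    induction k with
    | zero => intro u hu; rwa [pow_zero, mul_one]
    | succ k ih =>
      intro u hu
      rw [pow_succ, ← mul_assoc]
      exact hg _ (ih u hu)
  obtain ⟨k, S, rfl | rfl⟩ := hv <;> rw [← mul_assoc] <;> apply hcut
  · exact hpow _ hx k u hu
  · exact hpow _ hy k u hu

theorem IsTranslation.mul {u v : Pres n} (hu : IsTranslation u) (hv : IsTranslation v)
    (hn : 1 ≤ n) : IsTranslation (u * v) :=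
  hv.mul_induction (fun _ h => h.mul_x hn) (fun _ h => h.mul_y hn) (fun _ j h => h.mul_e j) hu

/-! ### The letters of rank two -/

theorem w_cases {d : ℕ} (h1 : 0 < d) (h2 : d < n) (h3 : 2 * d ≠ n) :
    (∃ h : 1 ≤ d ∧ d ≤ (n - 1) / 2, w n d = cl n (Xs d h) ∧ w n (n - d) = cl n (Ys d h)) ∨
      ∃ i, ∃ h : 1 ≤ i ∧ i ≤ (n - 1) / 2, d = n - i ∧
        w n d = cl n (Ys i h) ∧ w n (n - d) = cl n (Xs i h) := by
  by_cases h : d ≤ (n - 1) / 2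
  · exact Or.inl ⟨⟨h1, h⟩, (cl_Xs _).symm, (cl_Ys _).symm⟩
  · have hd : 1 ≤ n - d ∧ n - d ≤ (n - 1) / 2 := by omega
    refine Or.inr ⟨n - d, hd, by omega, ?_, (cl_Xs _).symm⟩
    rw [cl_Ys]
    congr 1
    omega

theorem w_mul_e {d j : ℕ} (h1 : 0 < d) (h2 : d < n) (h3 : 2 * d ≠ n) (hj : j ≠ 1)
    (hj' : j ≠ n - d + 1) : w n d * e n j = w n d := by
  by_cases hjn : 1 ≤ j ∧ j ≤ n
  swap
  · rw [e_of_not hjn, mul_one]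
  rw [← cl_E hjn]
  rcases w_cases h1 h2 h3 with ⟨h, hw, -⟩ | ⟨i, h, rfl, hw, -⟩ <;> rw [hw, ← map_mul]
  · exact cl_eq (Rel.r7_x d j h (by omega) hjn.2 hj')
  · exact cl_eq (Rel.r8_y i j h (by omega) hjn.2 (by omega))

theorem e_mul_w {d j : ℕ} (h1 : 0 < d) (h2 : d < n) (h3 : 2 * d ≠ n) (hj : j ≠ 1)
    (hj' : j ≠ d + 1) : e n j * w n d = w n d := by
  by_cases hjn : 1 ≤ j ∧ j ≤ n
  swap
  · rw [e_of_not hjn, one_mul]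
  rw [← cl_E hjn]
  rcases w_cases h1 h2 h3 with ⟨h, hw, -⟩ | ⟨i, h, rfl, hw, -⟩ <;> rw [hw, ← map_mul]
  · exact cl_eq (Rel.r8_x d j h (by omega) hjn.2 hj')
  · exact cl_eq (Rel.r7_y i j h (by omega) hjn.2 hj')

theorem isTranslation_cl_Eprod {a b : ℕ} (ha : 1 ≤ a) (hb : b ≤ n) :
    IsTranslation (cl n (Eprod a b)) := by
  rw [cl_Eprod a b ha hb]
  exact isTranslation_cut _

theorem isTranslation_w_mul_e_one {d : ℕ} (h1 : 0 < d) (h2 : d < n) (h3 : 2 * d ≠ n) :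
    IsTranslation (w n d * e n 1) := by
  have hn : 1 ≤ n := by omega
  rw [← cl_E ⟨le_rfl, hn⟩]
  rcases w_cases h1 h2 h3 with ⟨h, hw, -⟩ | ⟨i, h, rfl, hw, -⟩ <;> rw [hw, ← map_mul]
  · rw [cl_eq (Rel.r9_x' d h), map_mul, map_mul, map_pow]
    exact (isTranslation_x_pow _).mul ((isTranslation_cl_Eprod (by omega) (by omega)).mul
      (isTranslation_cl_Eprod (by omega) (by omega)) hn) hn
  · rw [cl_eq (Rel.r9_y' i h), map_mul, map_mul, map_pow]
    exact (isTranslation_y_pow _).mul ((isTranslation_cl_Eprod (by omega) (by omega)).mul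
      (isTranslation_cl_Eprod (by omega) (by omega)) hn) hn

theorem isTranslation_e_one_mul_w {d : ℕ} (h1 : 0 < d) (h2 : d < n) (h3 : 2 * d ≠ n) :
    IsTranslation (e n 1 * w n d) := by
  have hn : 1 ≤ n := by omega
  have key := isTranslation_w_mul_e_one h1 h2 h3
  rw [← cl_E ⟨le_rfl, hn⟩] at key ⊢
  rcases w_cases h1 h2 h3 with ⟨h, hw, -⟩ | ⟨i, h, rfl, hw, -⟩ <;>
    rw [hw, ← map_mul] at key ⊢
  · rwa [cl_eq (Rel.r9_x d h)]
  · rwa [cl_eq (Rel.r9_y i h)]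

theorem e_mul_w_self {d : ℕ} (h1 : 0 < d) (h2 : d < n) (h3 : 2 * d ≠ n) :
    e n (d + 1) * w n d = cl n (Eprod 2 n) := by
  rw [← cl_E ⟨by omega, by omega⟩]
  rcases w_cases h1 h2 h3 with ⟨h, hw, -⟩ | ⟨i, h, rfl, hw, -⟩ <;> rw [hw, ← map_mul]
  · rw [cl_eq (Rel.r10_b d h), cl_eq (Rel.r10_c d h), cl_eq (Rel.r10_d d h)]
  · exact cl_eq (Rel.r10_d i h)

theorem w_mul_e_self {d : ℕ} (h1 : 0 < d) (h2 : d < n) (h3 : 2 * d ≠ n) :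
    w n d * e n (n - d + 1) = cl n (Eprod 2 n) := by
  rcases w_cases h1 h2 h3 with ⟨h, hw, -⟩ | ⟨i, h, rfl, hw, -⟩
  · rw [← cl_E ⟨by omega, by omega⟩, hw, ← map_mul, cl_eq (Rel.r10_a d h),
      cl_eq (Rel.r10_b d h), cl_eq (Rel.r10_c d h), cl_eq (Rel.r10_d d h)]
  · have hi : n - (n - i) + 1 = i + 1 := by omega
    rw [hi, ← cl_E ⟨by omega, by omega⟩, hw, ← map_mul, cl_eq (Rel.r10_c i h),
      cl_eq (Rel.r10_d i h)]

theorem isTranslation_w_mul_w {d : ℕ} (h1 : 0 < d) (h2 : d < n) (h3 : 2 * d ≠ n) :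
    IsTranslation (w n d * w n (n - d)) := by
  rcases w_cases h1 h2 h3 with ⟨h, hw, hw'⟩ | ⟨i, h, rfl, hw, hw'⟩ <;> rw [hw, hw', ← map_mul]
  · rw [cl_eq (Rel.r6_xy d h), map_mul]
    exact (isTranslation_cl_Eprod (by omega) (by omega)).mul
      (isTranslation_cl_Eprod (by omega) (by omega)) (by omega)
  · rw [cl_eq (Rel.r6_yx i h), map_mul]
    exact (isTranslation_cl_Eprod (by omega) (by omega)).mul
      (isTranslation_cl_Eprod (by omega) (by omega)) (by omega)

/-! ### Normal forms -/

/-- The normal forms of the elements of the presented monoid. A word `y ^ a * w n d * x ^ b` names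
the map of rank `2` with `1 + a ↦ 1 + b` and `1 + a + d ↦ 1 + b + (n - d)`; the bounds on `a` and
`b` say that these points lie in `{1, …, n}`. -/
def IsNormal (u : Pres n) : Prop :=
  IsTranslation u ∨ ∃ d a b : ℕ, 0 < d ∧ d < n ∧ 2 * d ≠ n ∧ a + d < n ∧ b < d ∧
    u = y n ^ a * w n d * x n ^ b

theorem isNormal_y_pow_mul_w_mul_x_pow {d : ℕ} (h1 : 0 < d) (h2 : d < n) (h3 : 2 * d ≠ n)
    (a b : ℕ) : IsNormal (y n ^ a * w n d * x n ^ b) := by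
  have hn : 1 ≤ n := by omega
  have hE : IsTranslation (cl n (Eprod 2 n)) := isTranslation_cl_Eprod (by omega) le_rfl
  by_cases ha : a + d < n
  · by_cases hb : b < d
    · exact Or.inr ⟨d, a, b, h1, h2, h3, ha, hb, rfl⟩
    · left
      -- `x ^ b` absorbs the idempotent that moves `w n d` into the submonoid of translations
      rw [← e_mul_x_pow (k := b) (j := n - d + 1) (by omega) hn, mul_assoc, ← mul_assoc (w n d),
        w_mul_e_self h1 h2 h3]
      exact (isTranslation_y_pow a).mul (hE.mul (isTranslation_x_pow b) hn) hn
  · left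
    rw [← y_pow_mul_e (k := a) (j := d + 1) (by omega) hn, mul_assoc (y n ^ a),
      e_mul_w_self h1 h2 h3]
    exact ((isTranslation_y_pow a).mul hE hn).mul (isTranslation_x_pow b) hn

theorem IsNormal.mul_x {u : Pres n} (hu : IsNormal u) (hn : 1 ≤ n) : IsNormal (u * x n) := by
  obtain hu | ⟨d, a, b, h1, h2, h3, -, -, rfl⟩ := hu
  · exact Or.inl (hu.mul_x hn)
  · rw [mul_assoc, ← pow_succ]
    exact isNormal_y_pow_mul_w_mul_x_pow h1 h2 h3 a (b + 1)

theorem exists_x_pow_mul_e (b j : ℕ) (hn : 1 ≤ n) :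
    ∃ i, x n ^ b * e n j = e n i * x n ^ b := by
  induction b generalizing j with
  | zero => exact ⟨j, by rw [pow_zero, one_mul, mul_one]⟩
  | succ b ih =>
    by_cases hj : 1 ≤ j ∧ j ≤ n
    swap
    · exact ⟨j, by rw [e_of_not hj, one_mul, mul_one]⟩
    obtain ⟨i, rfl⟩ : ∃ i, j = i + 1 := ⟨j - 1, by omega⟩
    rcases Nat.eq_zero_or_pos i with rfl | hi
    · exact ⟨0, by rw [x_pow_mul_e (by omega) hn, e_of_not (by omega), one_mul]⟩
    · obtain ⟨l, hl⟩ := ih i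
      exact ⟨l, by rw [pow_succ, mul_assoc, ← e_mul_x hi (by omega), ← mul_assoc, hl, mul_assoc]⟩

theorem IsNormal.mul_e {u : Pres n} (hu : IsNormal u) (j : ℕ) (hn : 1 ≤ n) :
    IsNormal (u * e n j) := by
  obtain hu | ⟨d, a, b, h1, h2, h3, -, -, rfl⟩ := hu
  · exact Or.inl (hu.mul_e j)
  · obtain ⟨i, hi⟩ := exists_x_pow_mul_e (n := n) b j hn
    rw [mul_assoc, hi, ← mul_assoc, mul_assoc (y n ^ a)]
    by_cases hi1 : i = 1
    · subst hi1
      exact Or.inl (((isTranslation_y_pow a).mul (isTranslation_w_mul_e_one h1 h2 h3) hn).mul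
        (isTranslation_x_pow b) hn)
    by_cases hi2 : i = n - d + 1
    · subst hi2
      rw [w_mul_e_self h1 h2 h3]
      exact Or.inl (((isTranslation_y_pow a).mul
        (isTranslation_cl_Eprod (by omega) le_rfl) hn).mul (isTranslation_x_pow b) hn)
    rw [w_mul_e h1 h2 h3 hi1 hi2]
    exact isNormal_y_pow_mul_w_mul_x_pow h1 h2 h3 a b

theorem IsNormal.mul_y {u : Pres n} (hu : IsNormal u) (hn : 1 ≤ n) : IsNormal (u * y n) := by
  obtain hu | ⟨d, a, b, h1, h2, h3, -, -, rfl⟩ := hu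
  · exact Or.inl (hu.mul_y hn)
  · rcases b with _ | b
    · left
      have h := ((isTranslation_y_pow a).mul (isTranslation_w_mul_e_one h1 h2 h3) hn).mul_y hn
      rw [pow_zero, mul_one]
      rwa [mul_assoc, mul_assoc (w n d), e_one_mul_y hn, ← mul_assoc] at h
    · rw [pow_succ, mul_assoc, mul_assoc (x n ^ b), x_mul_y hn, ← mul_assoc]
      exact (isNormal_y_pow_mul_w_mul_x_pow h1 h2 h3 a b).mul_e n hn

theorem IsNormal.mul_translation {u v : Pres n} (hu : IsNormal u) (hv : IsTranslation v)
    (hn : 1 ≤ n) : IsNormal (u * v) :=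
  hv.mul_induction (fun _ h => h.mul_x hn) (fun _ h => h.mul_y hn) (fun _ j h => h.mul_e j hn) hu

/-- The product of an idempotent and a letter of rank `2` is this letter or a translation. -/
theorem e_mul_w_cases {d : ℕ} (h1 : 0 < d) (h2 : d < n) (h3 : 2 * d ≠ n) (j : ℕ) :
    e n j * w n d = w n d ∨ IsTranslation (e n j * w n d) := by
  by_cases hj1 : j = 1
  · subst hj1
    exact Or.inr (isTranslation_e_one_mul_w h1 h2 h3)
  by_cases hj2 : j = d + 1
  · subst hj2
    rw [e_mul_w_self h1 h2 h3]
    exact Or.inr (isTranslation_cl_Eprod (by omega) le_rfl)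
  exact Or.inl (e_mul_w h1 h2 h3 hj1 hj2)

theorem cut_mul_w_cases {d : ℕ} (h1 : 0 < d) (h2 : d < n) (h3 : 2 * d ≠ n) (S : Finset ℕ) :
    cut n S * w n d = w n d ∨ IsTranslation (cut n S * w n d) := by
  have hn : 1 ≤ n := by omega
  induction S using Finset.induction_on with
  | empty => exact Or.inl (by rw [cut_empty, one_mul])
  | insert j S _ ih =>
    rw [cut_insert, mul_assoc]
    rcases ih with ih | ih
    · rw [ih]
      exact e_mul_w_cases h1 h2 h3 j
    · right
      have := (isTranslation_one.mul_e j).mul ih hn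
      rwa [one_mul] at this

theorem IsNormal.mul_w {u : Pres n} (hu : IsNormal u) {d : ℕ} (h1 : 0 < d) (h2 : d < n)
    (h3 : 2 * d ≠ n) : IsNormal (u * w n d) := by
  have hn : 1 ≤ n := by omega
  -- `x = x * e_1`, and `e_1 * w n d` is a translation
  have hx : IsTranslation (x n * w n d) := by
    rw [← x_mul_e_one hn, mul_assoc, ← pow_one (x n)]
    exact (isTranslation_x_pow 1).mul (isTranslation_e_one_mul_w h1 h2 h3) hn
  obtain ⟨k, S, rfl | rfl⟩ | ⟨c, a, b, hc1, hc2, hc3, -, -, rfl⟩ := hu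
  · rw [mul_assoc]
    rcases cut_mul_w_cases h1 h2 h3 S with h | h
    · rw [h]
      rcases k with _ | k
      · simpa using isNormal_y_pow_mul_w_mul_x_pow h1 h2 h3 0 0
      · rw [pow_succ, mul_assoc]
        exact Or.inl ((isTranslation_x_pow k).mul hx hn)
    · exact Or.inl ((isTranslation_x_pow k).mul h hn)
  · rw [mul_assoc]
    rcases cut_mul_w_cases h1 h2 h3 S with h | h
    · rw [h]
      simpa using isNormal_y_pow_mul_w_mul_x_pow h1 h2 h3 k 0
    · exact Or.inl ((isTranslation_y_pow k).mul h hn)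
  · rcases b with _ | b
    · rw [pow_zero, mul_one]
      by_cases hcd : c + d = n
      · obtain rfl : d = n - c := by omega
        rw [mul_assoc]
        exact Or.inl ((isTranslation_y_pow a).mul (isTranslation_w_mul_w hc1 hc2 hc3) hn)
      · -- `w n c` absorbs `e_{d+1}`, because `d + 1` is not in its image
        rw [← w_mul_e (j := d + 1) hc1 hc2 hc3 (by omega) (by omega), ← mul_assoc, mul_assoc,
          e_mul_w_self h1 h2 h3]
        have := isNormal_y_pow_mul_w_mul_x_pow hc1 hc2 hc3 a 0
        rw [pow_zero, mul_one] at this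
        exact this.mul_translation (isTranslation_cl_Eprod (by omega) le_rfl) hn
    · rw [pow_succ, mul_assoc, mul_assoc (x n ^ b), ← mul_assoc]
      exact (isNormal_y_pow_mul_w_mul_x_pow hc1 hc2 hc3 a b).mul_translation hx hn

/-- Every element of the presented monoid has a normal form. -/
theorem isNormal (hn : 1 ≤ n) (u : Pres n) : IsNormal u := by
  have step : ∀ (v : FreeMonoid (Letter n)) u, IsNormal u → IsNormal (u * cl n v) := by
    intro v
    induction v using FreeMonoid.inductionOn' with
    | one => intro u hu; rwa [map_one, mul_one]
    | of_mul a v ih =>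
      intro u hu
      rw [map_mul, ← mul_assoc]
      apply ih
      cases a with
      | x => exact hu.mul_x hn
      | y => exact hu.mul_y hn
      | e i hi =>
        have := hu.mul_e i hn
        rwa [← cl_E hi] at this
      | xs i hi =>
        have := hu.mul_w (d := i) (by omega) (by omega) (by omega)
        rwa [← cl_Xs hi] at this
      | ys i hi =>
        have := hu.mul_w (d := n - i) (by omega) (by omega) (by omega)
        rwa [← cl_Ys hi] at this
  obtain ⟨v, rfl⟩ := PresentedMonoid.surjective_mk u
  have := step v 1 (Or.inl isTranslation_one)
  rwa [one_mul] at this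

/-! ### Evaluation of normal forms -/

/-- The homomorphism that sends each letter to the partial permutation that it names. -/
def eval (hn : 4 ≤ n) : Pres n →* SymInv n :=
  PresentedMonoid.lift Letter.val fun _ _ h => lift_val_eq_of_rel hn h

theorem eval_cl_of (hn : 4 ≤ n) (a : Letter n) : eval hn (cl n (FreeMonoid.of a)) = a.val := rfl

theorem eval_x_pow_mapsTo (hn : 4 ≤ n) {k : ℕ} {p q : Fin n} :
    (eval hn (x n ^ k)).MapsTo p q ↔ q.val = p.val + k := by
  rw [map_pow, x, X, eval_cl_of]
  exact shift_pow_mapsTo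

theorem eval_y_pow_mapsTo (hn : 4 ≤ n) {k : ℕ} {p q : Fin n} :
    (eval hn (y n ^ k)).MapsTo p q ↔ p.val = q.val + k := by
  rw [map_pow, y, Y, eval_cl_of]
  exact shift_inverse_pow_mapsTo

theorem eval_mul_e_mapsTo (hn : 4 ≤ n) {u : Pres n} {j : ℕ} {p q : Fin n} :
    (eval hn (u * e n j)).MapsTo p q ↔ (eval hn u).MapsTo p q ∧ q.val + 1 ≠ j := by
  have hq := q.isLt
  by_cases hj : 1 ≤ j ∧ j ≤ n
  · rw [map_mul, ← cl_E hj, E, eval_cl_of]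
    exact mul_idem_mapsTo
  · rw [e_of_not hj, mul_one, iff_self_and]
    intro
    omega

theorem eval_mul_cut_mapsTo (hn : 4 ≤ n) {u : Pres n} {S : Finset ℕ} {p q : Fin n} :
    (eval hn (u * cut n S)).MapsTo p q ↔ (eval hn u).MapsTo p q ∧ q.val + 1 ∉ S := by
  induction S using Finset.induction_on generalizing u with
  | empty => simp [cut_empty]
  | insert j S _ ih =>
    rw [cut_insert, ← mul_assoc, ih, eval_mul_e_mapsTo, Finset.mem_insert, not_or, and_assoc]

theorem eval_w_mapsTo (hn : 4 ≤ n) {d : ℕ} (h1 : 0 < d) (h2 : d < n) (h3 : 2 * d ≠ n)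
    {p q : Fin n} :
    (eval hn (w n d)).MapsTo p q ↔ p.val = 0 ∧ q.val = 0 ∨ p.val = d ∧ q.val = n - d := by
  rcases w_cases h1 h2 h3 with ⟨h, hw, -⟩ | ⟨i, h, rfl, hw, -⟩
  · rw [hw, Xs, eval_cl_of]
    exact xElt_mapsTo (hi := h)
  · rw [hw, Ys, eval_cl_of, Letter.val, SymInv.inverse_mapsTo, xElt_mapsTo]
    omega

theorem eval_y_pow_mul_w_mul_x_pow_mapsTo (hn : 4 ≤ n) {d a b : ℕ} (h1 : 0 < d) (h2 : d < n)
    (h3 : 2 * d ≠ n) {p q : Fin n} :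
    (eval hn (y n ^ a * w n d * x n ^ b)).MapsTo p q ↔
      p.val = a ∧ q.val = b ∨ p.val = a + d ∧ q.val = b + (n - d) := by
  simp only [map_mul, SymInv.mul_mapsTo, eval_y_pow_mapsTo, eval_x_pow_mapsTo,
    eval_w_mapsTo hn h1 h2 h3]
  constructor
  · rintro ⟨r, ⟨s, hs⟩, hr⟩
    omega
  · rintro (h | h)
    · exact ⟨⟨0, by omega⟩, ⟨⟨0, by omega⟩, by simp only; omega, by simp⟩, by simp only; omega⟩
    · exact ⟨⟨n - d, by omega⟩, ⟨⟨d, by omega⟩, by simp only; omega, by simp⟩,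
        by simp only; omega⟩

/-! ### Uniqueness of normal forms -/

theorem cut_Icc_one (hn : 1 ≤ n) :
    cut n (Finset.Icc 1 n) = e n 1 * cut n (Finset.Icc 2 n) := by
  rw [← cut_insert]
  congr 1
  ext j
  simp only [Finset.mem_Icc, Finset.mem_insert]
  omega

/-- The word `e_1 ⋯ e_n`, which names the empty map, is fixed by `x` on the left. -/
theorem x_mul_cut_Icc_one (hn : 1 ≤ n) :
    x n * cut n (Finset.Icc 1 n) = cut n (Finset.Icc 1 n) := by
  rw [cut_Icc_one hn, ← mul_assoc, x_mul_e_one hn, ← cl_Eprod 2 n (by omega) le_rfl, x,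
    ← map_mul, cl_eq Rel.r11, cl_Eprod 1 n le_rfl le_rfl, cut_Icc_one hn,
    cl_Eprod 2 n (by omega) le_rfl]

theorem y_mul_cut_Icc_one (hn : 1 ≤ n) :
    y n * cut n (Finset.Icc 1 n) = cut n (Finset.Icc 1 n) := by
  nth_rw 1 [← x_mul_cut_Icc_one hn]
  rw [← mul_assoc, y_mul_x hn, cut_Icc_one hn, ← mul_assoc, e_mul_self]

theorem pow_mul_cut_Icc_one {g : Pres n}
    (hg : g * cut n (Finset.Icc 1 n) = cut n (Finset.Icc 1 n)) (k : ℕ) :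
    g ^ k * cut n (Finset.Icc 1 n) = cut n (Finset.Icc 1 n) := by
  induction k with
  | zero => rw [pow_zero, one_mul]
  | succ k ih => rw [pow_succ, mul_assoc, hg, ih]

theorem x_pow_mul_cut_congr (hn : 1 ≤ n) {k : ℕ} {S T : Finset ℕ}
    (h : ∀ p q : Fin n, q.val = p.val + k → (q.val + 1 ∈ S ↔ q.val + 1 ∈ T)) :
    x n ^ k * cut n S = x n ^ k * cut n T := by
  refine mul_cut_congr fun j => ?_
  by_cases hj : k < j ∧ j ≤ n
  · right
    have := h ⟨j - 1 - k, by omega⟩ ⟨j - 1, by omega⟩ (by simp only; omega)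
    rwa [show j - 1 + 1 = j by omega] at this
  · left
    by_cases hjk : j ≤ k
    · exact x_pow_mul_e hjk hn
    · rw [e_of_not (by omega), mul_one]

theorem y_pow_mul_cut_congr (hn : 1 ≤ n) {k : ℕ} {S T : Finset ℕ}
    (h : ∀ p q : Fin n, p.val = q.val + k → (q.val + 1 ∈ S ↔ q.val + 1 ∈ T)) :
    y n ^ k * cut n S = y n ^ k * cut n T := by
  refine mul_cut_congr fun j => ?_
  by_cases hj : 1 ≤ j ∧ j + k ≤ n
  · right
    have := h ⟨j - 1 + k, by omega⟩ ⟨j - 1, by omega⟩ (by simp only)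
    rwa [show j - 1 + 1 = j by omega] at this
  · left
    by_cases hjk : n + 1 ≤ j + k
    · exact y_pow_mul_e hjk hn
    · rw [e_of_not (by omega), mul_one]

/-- A translation word that names the empty map equals `e_1 ⋯ e_n`. -/
theorem IsTranslation.eq_cut_Icc_one (hn : 4 ≤ n) {u : Pres n} (hu : IsTranslation u)
    (h : ∀ p q, ¬ (eval hn u).MapsTo p q) : u = cut n (Finset.Icc 1 n) := by
  have hn1 : 1 ≤ n := by omega
  have hmem : ∀ q : Fin n, q.val + 1 ∈ Finset.Icc 1 n := fun q => by
    rw [Finset.mem_Icc]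
    omega
  obtain ⟨k, S, rfl | rfl⟩ := hu
  · simp only [eval_mul_cut_mapsTo, eval_x_pow_mapsTo, not_and, not_not] at h
    rw [x_pow_mul_cut_congr hn1 fun p q hpq => iff_of_true (h p q hpq) (hmem q)]
    exact pow_mul_cut_Icc_one (x_mul_cut_Icc_one hn1) k
  · simp only [eval_mul_cut_mapsTo, eval_y_pow_mapsTo, not_and, not_not] at h
    rw [y_pow_mul_cut_congr hn1 fun p q hpq => iff_of_true (h p q hpq) (hmem q)]
    exact pow_mul_cut_Icc_one (y_mul_cut_Icc_one hn1) k

theorem IsTranslation.eq_of_eval_eq (hn : 4 ≤ n) {u v : Pres n} (hu : IsTranslation u)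
    (hv : IsTranslation v) (h : eval hn u = eval hn v) : u = v := by
  have hn1 : 1 ≤ n := by omega
  by_cases hne : ∃ p q, (eval hn u).MapsTo p q
  swap
  · push Not at hne
    rw [hu.eq_cut_Icc_one hn hne, hv.eq_cut_Icc_one hn (h ▸ hne)]
  obtain ⟨p, q, hpq⟩ := hne
  have h' : ∀ p q, (eval hn u).MapsTo p q ↔ (eval hn v).MapsTo p q := fun p q => by rw [h]
  have hpq' := (h' p q).1 hpq
  obtain ⟨k, S, rfl | rfl⟩ := hu <;> obtain ⟨l, T, rfl | rfl⟩ := hv <;>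
    simp only [eval_mul_cut_mapsTo, eval_x_pow_mapsTo, eval_y_pow_mapsTo] at h' hpq hpq'
  · obtain rfl : k = l := by omega
    exact x_pow_mul_cut_congr hn1 fun p q hk => by simpa [hk, not_iff_not] using h' p q
  · -- a power of `x` and a power of `y` agree at a point only if both are trivial
    obtain rfl : k = 0 := by omega
    obtain rfl : l = 0 := by omega
    rw [pow_zero, ← pow_zero (x n)]
    exact x_pow_mul_cut_congr hn1 fun p q hk => by simpa [hk, not_iff_not] using h' p q
  · obtain rfl : k = 0 := by omega
    obtain rfl : l = 0 := by omega
    rw [pow_zero, ← pow_zero (x n)]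
    exact x_pow_mul_cut_congr hn1 fun p q hk => by simpa [hk, not_iff_not] using h' p q
  · obtain rfl : k = l := by omega
    exact y_pow_mul_cut_congr hn1 fun p q hk => by simpa [hk, not_iff_not] using h' p q

theorem IsTranslation.displacement (hn : 4 ≤ n) {u : Pres n} (hu : IsTranslation u)
    {p q p' q' : Fin n} (hp : (eval hn u).MapsTo p p') (hq : (eval hn u).MapsTo q q') :
    q'.val + p.val = p'.val + q.val := by
  obtain ⟨k, S, rfl | rfl⟩ := hu <;>
    simp only [eval_mul_cut_mapsTo, eval_x_pow_mapsTo, eval_y_pow_mapsTo] at hp hq <;> omega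

/-- A translation and a normal form of rank `2` name different maps. -/
theorem IsTranslation.eval_ne (hn : 4 ≤ n) {u : Pres n} (hu : IsTranslation u) {d a b : ℕ}
    (h1 : 0 < d) (h2 : d < n) (h3 : 2 * d ≠ n) (ha : a + d < n) (hb : b < d) :
    eval hn u ≠ eval hn (y n ^ a * w n d * x n ^ b) := by
  intro h
  have hp : (eval hn u).MapsTo ⟨a, by omega⟩ ⟨b, by omega⟩ := by
    rw [h, eval_y_pow_mul_w_mul_x_pow_mapsTo hn h1 h2 h3]
    exact Or.inl ⟨rfl, rfl⟩
  have hq : (eval hn u).MapsTo ⟨a + d, by omega⟩ ⟨b + (n - d), by omega⟩ := by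
    rw [h, eval_y_pow_mul_w_mul_x_pow_mapsTo hn h1 h2 h3]
    exact Or.inr ⟨rfl, rfl⟩
  have := hu.displacement hn hp hq
  simp only at this
  omega

theorem eval_injective (hn : 4 ≤ n) : Function.Injective (eval (n := n) hn) := by
  intro u v h
  rcases isNormal (by omega) u with hu | ⟨d, a, b, h1, h2, h3, ha, hb, rfl⟩ <;>
    rcases isNormal (by omega) v with hv | ⟨d', a', b', h1', h2', h3', ha', hb', rfl⟩
  · exact hu.eq_of_eval_eq hn hv h
  · exact (hu.eval_ne hn h1' h2' h3' ha' hb' h).elim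
  · exact (hv.eval_ne hn h1 h2 h3 ha hb h.symm).elim
  · have h' := fun p q => (congrArg (fun α => SymInv.MapsTo α p q) h).to_iff
    simp only [eval_y_pow_mul_w_mul_x_pow_mapsTo hn h1 h2 h3,
      eval_y_pow_mul_w_mul_x_pow_mapsTo hn h1' h2' h3'] at h'
    have k1 := (h' ⟨a, by omega⟩ ⟨b, by omega⟩).1 (Or.inl ⟨rfl, rfl⟩)
    have k2 := (h' ⟨a + d, by omega⟩ ⟨b + (n - d), by omega⟩).1 (Or.inr ⟨rfl, rfl⟩)
    simp only at k1 k2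
    obtain rfl : a = a' := by omega
    obtain rfl : b = b' := by omega
    obtain rfl : d = d' := by omega
    rfl

/-! ### The isomorphism -/

theorem eval_mem_ODI (hn : 4 ≤ n) (u : Pres n) : eval hn u ∈ ODI n := by
  obtain ⟨v, rfl⟩ := PresentedMonoid.surjective_mk u
  induction v using FreeMonoid.inductionOn' with
  | one => rw [map_one, map_one]; exact one_mem _
  | of_mul a v ih =>
    rw [map_mul, map_mul]
    exact mul_mem (eval_cl_of hn a ▸ a.val_mem_ODI) ih

theorem exists_eval_eq (hn : 4 ≤ n) {α : SymInv n} (hα : α ∈ ODI n) :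
    ∃ u, eval hn u = α := by
  classical
  rcases ODI_cases hα with ⟨c, hc⟩ | ⟨a, d, b, h1, ha, hb, h3, h⟩
  · -- the translation by `c`, cut down to the image of `α`
    let S : Finset ℕ := (Finset.Icc 1 n).filter fun j =>
      ∀ p q : Fin n, α.MapsTo p q → q.val + 1 ≠ j
    have hS : ∀ q : Fin n, q.val + 1 ∉ S ↔ ∃ p, α.MapsTo p q := by
      intro q
      have hq := q.isLt
      simp only [S, Finset.mem_filter, Finset.mem_Icc, not_and, not_forall, not_not]
      constructor
      · intro h
        obtain ⟨p, q', hp, hq'⟩ := h (by omega)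
        obtain rfl : q' = q := Fin.ext (by omega)
        exact ⟨p, hp⟩
      · rintro ⟨p, hp⟩ -
        exact ⟨p, q, hp, rfl⟩
    have hα' : ∀ p q : Fin n, ((q : ℕ) : ℤ) = (p : ℕ) + c ∧ q.val + 1 ∉ S ↔ α.MapsTo p q := by
      intro p q
      rw [hS]
      constructor
      · rintro ⟨hpq, r, hr⟩
        have := hc r q hr
        obtain rfl : r = p := Fin.ext (by omega)
        exact hr
      · intro h
        exact ⟨hc p q h, p, h⟩
    rcases le_total 0 c with h0 | h0
    · refine ⟨x n ^ c.toNat * cut n S, SymInv.ext fun p q => ?_⟩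
      rw [eval_mul_cut_mapsTo, eval_x_pow_mapsTo, ← hα']
      exact and_congr_left fun _ => by omega
    · refine ⟨y n ^ (-c).toNat * cut n S, SymInv.ext fun p q => ?_⟩
      rw [eval_mul_cut_mapsTo, eval_y_pow_mapsTo, ← hα']
      exact and_congr_left fun _ => by omega
  · refine ⟨y n ^ a * w n d * x n ^ b, SymInv.ext fun p q => ?_⟩
    rw [eval_y_pow_mul_w_mul_x_pow_mapsTo hn h1 (by omega) h3, h]

/-- The isomorphism from the presented monoid onto `ODI n` that is induced by the naming of the
letters. -/
noncomputable def equivODI (hn : 4 ≤ n) : Pres n ≃* ODI n :=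
  MulEquiv.ofBijective ((eval hn).codRestrict (ODI n) (eval_mem_ODI hn))
    ⟨fun _ _ h => eval_injective hn (congrArg Subtype.val h), fun α =>
      (exists_eval_eq hn α.2).imp fun _ hu => Subtype.ext hu⟩

end Pres

/-! ### The numbers of letters and of relations -/

theorem card_letter (n : ℕ) : Nat.card (Letter n) = 2 + n + 2 * ((n - 1) / 2) := by
  let f : Letter n ≃ Bool ⊕ Fin n ⊕ Fin ((n - 1) / 2) ⊕ Fin ((n - 1) / 2) :=
    { toFun := fun
        | .x => .inl true
        | .y => .inl false
        | .e i hi => .inr (.inl ⟨i - 1, by omega⟩)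
        | .xs i hi => .inr (.inr (.inl ⟨i - 1, by omega⟩))
        | .ys i hi => .inr (.inr (.inr ⟨i - 1, by omega⟩))
      invFun := fun
        | .inl true => .x
        | .inl false => .y
        | .inr (.inl i) => .e (i + 1) (by omega)
        | .inr (.inr (.inl i)) => .xs (i + 1) (by omega)
        | .inr (.inr (.inr i)) => .ys (i + 1) (by omega)
      left_inv := by
        rintro (_ | _ | ⟨i, hi⟩ | ⟨i, hi⟩ | ⟨i, hi⟩) <;> simp <;> omega
      right_inv := by
        rintro ((_ | _) | i | i | i) <;> simp }
  rw [Nat.card_congr f]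
  simp
  omega

/-- An index type for the left-hand sides of the relations: the words `e_i e_j` with `i ≤ j`, the
words `e_i x` with `i < n`, the words `x_i y_i` and `y_i x_i`, the words `x_i e_j`, `e_j x_i`,
`y_i e_j` and `e_j y_i`, and the five words `x y`, `y x`, `x e_1`, `e_1 y` and `x e_2 ⋯ e_n`. -/
abbrev LhsIndex (n : ℕ) : Type :=
  {p : Fin n × Fin n // p.1 ≤ p.2} ⊕ Fin (n - 1) ⊕ (Bool × Fin ((n - 1) / 2)) ⊕
    ((Bool × Bool) × Fin ((n - 1) / 2) × Fin n) ⊕ Fin 5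

theorem card_lhsIndex (n : ℕ) :
    Nat.card (LhsIndex n) =
      n * (n + 1) / 2 + (n - 1) + 2 * ((n - 1) / 2) + 4 * ((n - 1) / 2 * n) + 5 := by
  have h : Nat.card {p : Fin n × Fin n // p.1 ≤ p.2} = n * (n + 1) / 2 := by
    rw [← Nat.card_congr Sym2.sortEquiv, Nat.card_eq_fintype_card, Sym2.card, Fintype.card_fin,
      Nat.choose_two_right, Nat.add_sub_cancel, Nat.mul_comm]
  simp only [LhsIndex, Nat.card_sum, Nat.card_prod, h]
  simp
  omega

/-- The left-hand side with a given index. The indices of letters count from `0` here. -/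
def relLhs {n : ℕ} (hn : 4 ≤ n) : LhsIndex n → FreeMonoid (Letter n)
  | .inl ⟨(i, j), _⟩ => E (i + 1) (by omega) * E (j + 1) (by omega)
  | .inr (.inl i) => E (i + 1) (by omega) * X
  | .inr (.inr (.inl (true, i))) => Xs (i + 1) (by omega) * Ys (i + 1) (by omega)
  | .inr (.inr (.inl (false, i))) => Ys (i + 1) (by omega) * Xs (i + 1) (by omega)
  | .inr (.inr (.inr (.inl ((true, true), i, j)))) =>
      Xs (i + 1) (by omega) * E (j + 1) (by omega)
  | .inr (.inr (.inr (.inl ((true, false), i, j)))) =>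
      E (j + 1) (by omega) * Xs (i + 1) (by omega)
  | .inr (.inr (.inr (.inl ((false, true), i, j)))) =>
      Ys (i + 1) (by omega) * E (j + 1) (by omega)
  | .inr (.inr (.inr (.inl ((false, false), i, j)))) =>
      E (j + 1) (by omega) * Ys (i + 1) (by omega)
  | .inr (.inr (.inr (.inr 0))) => X * Y
  | .inr (.inr (.inr (.inr 1))) => Y * X
  | .inr (.inr (.inr (.inr 2))) => X * E 1 (by omega)
  | .inr (.inr (.inr (.inr 3))) => E 1 (by omega) * Y
  | .inr (.inr (.inr (.inr 4))) => X * Eprod 2 n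

/-- The right-hand side of the relation whose left-hand side has a given index. -/
def relRhs {n : ℕ} (hn : 4 ≤ n) : LhsIndex n → FreeMonoid (Letter n)
  | .inl ⟨(i, j), _⟩ =>
      if i = j then E (i + 1) (by omega) else E (j + 1) (by omega) * E (i + 1) (by omega)
  | .inr (.inl i) => X * E (i + 1 + 1) (by omega)
  | .inr (.inr (.inl (true, i))) => Eprod 2 (i + 1) * Eprod (i + 1 + 2) n
  | .inr (.inr (.inl (false, i))) => Eprod 2 (n - (i + 1)) * Eprod (n - (i + 1) + 2) n
  | .inr (.inr (.inr (.inl ((true, true), i, j)))) =>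
      if j.val = 0 then X ^ (n - 2 * (i + 1)) *
        (Eprod (n - 2 * (i + 1) + 1) (n - (i + 1)) * Eprod (n - (i + 1) + 2) n)
      else if j.val = n - (i + 1) then E (i + 1 + 1) (by omega) * Xs (i + 1) (by omega)
      else Xs (i + 1) (by omega)
  | .inr (.inr (.inr (.inl ((true, false), i, j)))) =>
      if j.val = 0 then Xs (i + 1) (by omega) * E 1 (by omega)
      else if j.val = i + 1 then Ys (i + 1) (by omega) * E (i + 1 + 1) (by omega)
      else Xs (i + 1) (by omega)
  | .inr (.inr (.inr (.inl ((false, true), i, j)))) =>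
      if j.val = 0 then Y ^ (n - 2 * (i + 1)) *
        (Eprod 1 (i + 1) * Eprod (i + 1 + 2) (2 * (i + 1)))
      else if j.val = i + 1 then E (n - (i + 1) + 1) (by omega) * Ys (i + 1) (by omega)
      else Ys (i + 1) (by omega)
  | .inr (.inr (.inr (.inl ((false, false), i, j)))) =>
      if j.val = 0 then Ys (i + 1) (by omega) * E 1 (by omega)
      else if j.val = n - (i + 1) then Eprod 2 n
      else Ys (i + 1) (by omega)
  | .inr (.inr (.inr (.inr 0))) => E n (by omega)
  | .inr (.inr (.inr (.inr 1))) => E 1 (by omega)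
  | .inr (.inr (.inr (.inr 2))) => X
  | .inr (.inr (.inr (.inr 3))) => Y
  | .inr (.inr (.inr (.inr 4))) => Eprod 1 n

theorem rel_relLhs_relRhs {n : ℕ} (hn : 4 ≤ n) (k : LhsIndex n) :
    Rel n (relLhs hn k) (relRhs hn k) := by
  rcases k with ⟨⟨i, j⟩, hij⟩ | i | ⟨_ | _, i⟩ | ⟨⟨_ | _, _ | _⟩, i, j⟩ | k
  · by_cases h : i = j
    · subst h
      simpa only [relLhs, relRhs, pow_two, if_true] using Rel.r1 (n := n) (i + 1) (by omega)
    · simp only [relLhs, relRhs, if_neg h]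
      have h' : i.val ≠ j.val := fun h' => h (Fin.ext h')
      have : i.val ≤ j.val := hij
      exact Rel.r4 (i + 1) (j + 1) (by omega) (by omega) (by omega)
  · exact Rel.r5 (i + 1) (by omega) (by omega)
  · exact Rel.r6_yx (i + 1) (by omega)
  · exact Rel.r6_xy (i + 1) (by omega)
  · simp only [relLhs, relRhs]
    split_ifs with h1 h2
    · simp only [h1]
      exact Rel.r9_y (i + 1) (by omega)
    · simp only [h2]
      exact Rel.r10_d (i + 1) (by omega)
    · exact Rel.r7_y (i + 1) (j + 1) (by omega) (by omega) (by omega) (by omega)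
  · simp only [relLhs, relRhs]
    split_ifs with h1 h2
    · simp only [h1]
      exact Rel.r9_y' (i + 1) (by omega)
    · simp only [h2]
      exact Rel.r10_c (i + 1) (by omega)
    · exact Rel.r8_y (i + 1) (j + 1) (by omega) (by omega) (by omega) (by omega)
  · simp only [relLhs, relRhs]
    split_ifs with h1 h2
    · simp only [h1]
      exact Rel.r9_x (i + 1) (by omega)
    · simp only [h2]
      exact Rel.r10_b (i + 1) (by omega)
    · exact Rel.r8_x (i + 1) (j + 1) (by omega) (by omega) (by omega) (by omega)
  · simp only [relLhs, relRhs]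
    split_ifs with h1 h2
    · simp only [h1]
      exact Rel.r9_x' (i + 1) (by omega)
    · simp only [h2]
      exact Rel.r10_a (i + 1) (by omega)
    · exact Rel.r7_x (i + 1) (j + 1) (by omega) (by omega) (by omega) (by omega)
  · fin_cases k
    · exact Rel.r2_xy (by omega)
    · exact Rel.r2_yx (by omega)
    · exact Rel.r3_x (by omega)
    · exact Rel.r3_y (by omega)
    · exact Rel.r11

theorem exists_index_of_rel {n : ℕ} (hn : 4 ≤ n) {u v : FreeMonoid (Letter n)} (h : Rel n u v) :
    ∃ k, (relLhs hn k, relRhs hn k) = (u, v) := by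
  have hsub : ∀ i : ℕ, 1 ≤ i → i - 1 + 1 = i := fun i hi => by omega
  cases h with
  | r1 i hi =>
    refine ⟨.inl ⟨(⟨i - 1, by omega⟩, ⟨i - 1, by omega⟩), le_rfl⟩, ?_⟩
    simp only [relLhs, relRhs, if_true, hsub i hi.1, pow_two]
  | r2_xy => exact ⟨.inr (.inr (.inr (.inr 0))), rfl⟩
  | r2_yx => exact ⟨.inr (.inr (.inr (.inr 1))), rfl⟩
  | r3_x => exact ⟨.inr (.inr (.inr (.inr 2))), rfl⟩
  | r3_y => exact ⟨.inr (.inr (.inr (.inr 3))), rfl⟩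
  | r11 => exact ⟨.inr (.inr (.inr (.inr 4))), rfl⟩
  | r4 i j hi hij hj =>
    refine ⟨.inl ⟨(⟨i - 1, by omega⟩, ⟨j - 1, by omega⟩), ?_⟩, ?_⟩
    · rw [Fin.mk_le_mk]
      omega
    · have h : i - 1 ≠ j - 1 := by omega
      simp only [relLhs, relRhs, Fin.mk.injEq, if_neg h, hsub i hi, hsub j (by omega)]
  | r5 i h1 h2 =>
    refine ⟨.inr (.inl ⟨i - 1, by omega⟩), ?_⟩
    simp only [relLhs, relRhs, hsub i h1]
  | r6_xy i hi =>
    refine ⟨.inr (.inr (.inl (true, ⟨i - 1, by omega⟩))), ?_⟩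
    simp only [relLhs, relRhs, hsub i hi.1]
  | r6_yx i hi =>
    refine ⟨.inr (.inr (.inl (false, ⟨i - 1, by omega⟩))), ?_⟩
    simp only [relLhs, relRhs, hsub i hi.1]
  | r7_x i j hi h1 h2 hj =>
    refine ⟨.inr (.inr (.inr (.inl ((true, true), ⟨i - 1, by omega⟩, ⟨j - 1, by omega⟩)))), ?_⟩
    simp only [relLhs, relRhs, hsub i hi.1, hsub j (by omega)]
    rw [if_neg (by omega), if_neg (by omega)]
  | r7_y i j hi h1 h2 hj =>
    refine ⟨.inr (.inr (.inr (.inl ((false, false), ⟨i - 1, by omega⟩, ⟨j - 1, by omega⟩)))), ?_⟩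
    simp only [relLhs, relRhs, hsub i hi.1, hsub j (by omega)]
    rw [if_neg (by omega), if_neg (by omega)]
  | r8_x i j hi h1 h2 hj =>
    refine ⟨.inr (.inr (.inr (.inl ((true, false), ⟨i - 1, by omega⟩, ⟨j - 1, by omega⟩)))), ?_⟩
    simp only [relLhs, relRhs, hsub i hi.1, hsub j (by omega)]
    rw [if_neg (by omega), if_neg (by omega)]
  | r8_y i j hi h1 h2 hj =>
    refine ⟨.inr (.inr (.inr (.inl ((false, true), ⟨i - 1, by omega⟩, ⟨j - 1, by omega⟩)))), ?_⟩
    simp only [relLhs, relRhs, hsub i hi.1, hsub j (by omega)]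
    rw [if_neg (by omega), if_neg (by omega)]
  | r9_x i hi =>
    refine ⟨.inr (.inr (.inr (.inl ((true, false), ⟨i - 1, by omega⟩, ⟨0, by omega⟩)))), ?_⟩
    simp only [relLhs, relRhs, hsub i hi.1, if_true, zero_add]
  | r9_x' i hi =>
    refine ⟨.inr (.inr (.inr (.inl ((true, true), ⟨i - 1, by omega⟩, ⟨0, by omega⟩)))), ?_⟩
    simp only [relLhs, relRhs, hsub i hi.1, if_true, zero_add]
  | r9_y i hi =>
    refine ⟨.inr (.inr (.inr (.inl ((false, false), ⟨i - 1, by omega⟩, ⟨0, by omega⟩)))), ?_⟩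
    simp only [relLhs, relRhs, hsub i hi.1, if_true, zero_add]
  | r9_y' i hi =>
    refine ⟨.inr (.inr (.inr (.inl ((false, true), ⟨i - 1, by omega⟩, ⟨0, by omega⟩)))), ?_⟩
    simp only [relLhs, relRhs, hsub i hi.1, if_true, zero_add]
  | r10_a i hi =>
    refine ⟨.inr (.inr (.inr (.inl ((true, true), ⟨i - 1, by omega⟩, ⟨n - i, by omega⟩)))), ?_⟩
    simp only [relLhs, relRhs, hsub i hi.1, if_true]
    rw [if_neg (by omega)]
  | r10_b i hi =>
    refine ⟨.inr (.inr (.inr (.inl ((true, false), ⟨i - 1, by omega⟩, ⟨i, by omega⟩)))), ?_⟩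
    simp only [relLhs, relRhs, hsub i hi.1, if_true]
    rw [if_neg (by omega)]
  | r10_c i hi =>
    refine ⟨.inr (.inr (.inr (.inl ((false, true), ⟨i - 1, by omega⟩, ⟨i, by omega⟩)))), ?_⟩
    simp only [relLhs, relRhs, hsub i hi.1, if_true]
    rw [if_neg (by omega)]
  | r10_d i hi =>
    refine ⟨.inr (.inr (.inr (.inl ((false, false), ⟨i - 1, by omega⟩, ⟨n - i, by omega⟩)))), ?_⟩
    simp only [relLhs, relRhs, hsub i hi.1, if_true]
    rw [if_neg (by omega)]

theorem of_mul_of_eq_iff {α : Type*} {a b c d : α} :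
    FreeMonoid.of a * FreeMonoid.of b = FreeMonoid.of c * FreeMonoid.of d ↔ a = c ∧ b = d := by
  rw [← FreeMonoid.toList.injective.eq_iff]
  simp

theorem X_mul_Eprod_ne {n : ℕ} (hn : 4 ≤ n) (a b : Letter n) :
    X * Eprod 2 n ≠ FreeMonoid.of a * FreeMonoid.of b := by
  intro h
  have h' := congrArg FreeMonoid.toList h
  simp only [X, FreeMonoid.toList_mul, FreeMonoid.toList_of, List.singleton_append,
    List.cons.injEq] at h'
  have hmem : ∀ j : ℕ, ∀ hj : 2 ≤ j ∧ j ≤ n,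
      Letter.e j (by omega) ∈ FreeMonoid.toList (Eprod (n := n) 2 n) := by
    intro j hj
    simp only [Eprod, FreeMonoid.toList_prod, List.mem_flatten, List.mem_map, List.mem_filter,
      List.mem_finRange, true_and, decide_eq_true_eq]
    refine ⟨_, ⟨_, ⟨⟨j - 1, by omega⟩, by simp only; omega, rfl⟩, rfl⟩, ?_⟩
    simp only [E, FreeMonoid.toList_of, List.mem_singleton, Letter.e.injEq]
    omega
  have h2 := hmem 2 (by omega)
  have h3 := hmem 3 (by omega)
  rw [h'.2, List.mem_singleton] at h2 h3
  simp [← h2] at h3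

theorem relLhs_injective {n : ℕ} (hn : 4 ≤ n) : Function.Injective (relLhs hn) := by
  rintro (⟨⟨i, j⟩, hij⟩ | i | ⟨_ | _, i⟩ | ⟨⟨_ | _, _ | _⟩, i, j⟩ | k)
    (⟨⟨i', j'⟩, hij'⟩ | i' | ⟨_ | _, i'⟩ | ⟨⟨_ | _, _ | _⟩, i', j'⟩ | k') h
  all_goals try fin_cases k
  all_goals try fin_cases k'
  all_goals first
    | rfl
    | exact (X_mul_Eprod_ne hn _ _ h).elim
    | exact (X_mul_Eprod_ne hn _ _ h.symm).elim
    | simp [relLhs, E, X, Y, Xs, Ys, of_mul_of_eq_iff, FreeMonoid.of_injective.eq_iff] at h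
      done
    | simpa [relLhs, E, X, Y, Xs, Ys, of_mul_of_eq_iff, FreeMonoid.of_injective.eq_iff,
        Fin.val_inj, and_comm] using h

theorem ncard_rel {n : ℕ} (hn : 4 ≤ n) :
    Set.ncard {r : FreeMonoid (Letter n) × FreeMonoid (Letter n) | Rel n r.1 r.2} =
      n * (n + 1) / 2 + (n - 1) + 2 * ((n - 1) / 2) + 4 * ((n - 1) / 2 * n) + 5 := by
  have hset : {r : FreeMonoid (Letter n) × FreeMonoid (Letter n) | Rel n r.1 r.2} =
      Set.range fun k => (relLhs hn k, relRhs hn k) := by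
    ext ⟨u, v⟩
    constructor
    · exact exists_index_of_rel hn
    · rintro ⟨k, hk⟩
      rw [Prod.mk.injEq] at hk
      rw [← hk.1, ← hk.2]
      exact rel_relLhs_relRhs hn k
  rw [hset, Set.ncard_range_of_injective fun k l h => relLhs_injective hn (Prod.mk.inj h).1,
    card_lhsIndex]

end DihedralInverse

theorem theorem3p6 (n : ℕ) (hn : 4 ≤ n) :
    (∃ Φ : PresentedMonoid (DihedralInverse.Rel n) ≃* DihedralInverse.ODI n,
      ∀ a : DihedralInverse.Letter n,
        (Φ (PresentedMonoid.of (DihedralInverse.Rel n) a) : DihedralInverse.SymInv n) = a.val) ∧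
    (Nat.card (DihedralInverse.Letter n) : ℚ) = 2 * (n : ℚ) + (1 - (-1) ^ n) / 2 ∧
    (Set.ncard {r : FreeMonoid (DihedralInverse.Letter n) × FreeMonoid (DihedralInverse.Letter n) |
        DihedralInverse.Rel n r.1 r.2} : ℚ) =
      (5 * (n : ℚ) ^ 2 - (1 + 2 * (-1) ^ n) * (n : ℚ) + (-1) ^ (n + 1) + 5) / 2 := by
  refine ⟨⟨DihedralInverse.Pres.equivODI hn, fun a => DihedralInverse.Pres.eval_cl_of hn a⟩, ?_⟩
  rw [DihedralInverse.card_letter, DihedralInverse.ncard_rel hn, pow_succ (-1 : ℚ) n]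
  rcases Nat.even_or_odd' n with ⟨k, rfl | rfl⟩
  · obtain ⟨l, rfl⟩ : ∃ l, k = l + 1 := ⟨k - 1, by omega⟩
    have h1 : (2 * (l + 1) - 1) / 2 = l := by omega
    have h2 : 2 * (l + 1) * (2 * (l + 1) + 1) / 2 = (l + 1) * (2 * (l + 1) + 1) := by
      rw [mul_assoc, Nat.mul_div_cancel_left _ two_pos]
    have h3 : 2 * (l + 1) - 1 = 2 * l + 1 := by omega
    rw [h1, h2, h3, Even.neg_one_pow (even_two_mul _)]
    push_cast
    constructor <;> ring
  · have h1 : (2 * k + 1 - 1) / 2 = k := by omega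
    have h2 : (2 * k + 1) * (2 * k + 1 + 1) / 2 = (2 * k + 1) * (k + 1) := by
      rw [show (2 * k + 1) * (2 * k + 1 + 1) = 2 * ((2 * k + 1) * (k + 1)) by ring,
        Nat.mul_div_cancel_left _ two_pos]
    have h3 : 2 * k + 1 - 1 = 2 * k := by omega
    rw [h1, h2, h3, Odd.neg_one_pow (odd_two_mul_add_one _)]
    push_cast
    constructor <;> ring
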